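/- **Conventions.** For a field $K$ let $\Sigma_K$ be the set of equivalence classes ("places") of nontrivial absolute values $K\to\mathbb R_{\ge 0}$ (two being equivalent if they are $<1$ at the same elements). A place $P$ is archimedean if it contains an absolute value $\varphi$ with $\varphi(x+y)>\max(\varphi(x),\varphi(y))$ for some $x,y$. Write $\widehat K_P$ for the completion of $K$ at $P$. Put $N(P)=e^{\dim_{\mathbb R}\widehat K_P}$ if $P$ is archimedean, and let $N(P)$ be the cardinality of the residue field of $P$ otherwise. A divisor on $K$ is a finite formal sum $D=\sum_{P\in\Sigma_K} a_P\cdot P$ with $a_P\in\mathbb R$ for $P$ archimedean and $a_P\in\mathbb Z$ otherwise; its degree is $\deg D=\prod_P N(P)^{a_P}$. Let $L/K$ be a finite separable extension of global fields. For $Q\in\Sigma_L$ and $P\in\Sigma_K$ the place below it: * if $Q$ is archimedean, then $e_Q=[\widehat L_Q:\widehat K_P]$, and $r_Q=-\log\log N(Q)$ if $e_Q\ne1$, $r_Q=0$ if $e_Q=1$; * if $Q$ is nonarchimedean, then $e_Q$ is the index of the value group of $K$ in the value group of $L$, both taken with respect to an absolute value in $Q$, and $r_Q$ is the exponent of the maximal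 ideal of the valuation ring of $\widehat L_Q$ in the different of that ring over the valuation ring of $\widehat K_P$. The ramification divisor is $R_{L/K}=\sum_{Q\in\Sigma_L} r_Q\cdot Q$. Let $K_0$ be $\mathbb Q$ or the rational function field $\mathbb F_q(t)$ over a finite field $\mathbb F_q$, and let $K/K_0$ be a finite separable extension. Choose a nonarchimedean place $P_0$ of $K_0$, with $N(P_0)=q$ if $K_0=\mathbb F_q(t)$, and let $S_0$ be the set of places of $K$ above $P_0$. With $r_P$, $e_P$ taken relative to $K/K_0$, put $$\omega'_K=R_{K/K_0}-\sum_{P\in S_0}2e_P\cdot P\quad\text{if }K_0=\mathbb F_q(t),$$ $$\omega'_K=R_{K/\mathbb Q}-\sum_{P\in S_0}2e_P\cdot P+a_\infty\cdot P_\infty,\qquad a_\infty=\sum_{P\in S_0}2e_P\log_{N(P_\infty)}N(P)\quad\text{if }K_0=\mathbb Q,$$ where $P_\infty$ is a chosen archimedean place of $K$. **Theorem.** Let $K_0$ be $\mathbb Q$ or $\mathbb F_q(t)$, let $K/K_0$ be a finite separable extension, and let $L/K$ be a finite separable extension (so that $L_0=K_0$). Then $R_{L/K}$, $\omega'_K$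 and $\omega'_L$ are divisors (their coefficients vanish at all but finitely many places and are integers at the nonarchimedean ones), and $$\deg\omega'_L=\bigl(\deg\omega'_K\bigr)^{[L:K]}\cdot\deg R_{L/K},$$ for all choices of $P_0$ and $P_\infty$ made in the definitions of $\omega'_K$ and of $\omega'_L$ (the choices for $K$ and for $L$ may be made independently). -/

import Mathlib

noncomputable section

namespace GlobalField

universe u v

/-! ### Places of a field -/

section Places

variable (K : Type u) [Field K]

/-- Equivalence of nontrivial real absolute values; equivalently (`AbsoluteValue.isEquiv_iff_lt_one_iff`)
`v x < 1 ↔ w x < 1` for all `x`. -/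
instance placeSetoid : Setoid {w : AbsoluteValue K ℝ // w.IsNontrivial} :=
  Setoid.comap Subtype.val (inferInstance : Setoid (AbsoluteValue K ℝ))

/-- The set `Σ_K` of equivalence classes of nontrivial absolute values on `K`. -/
def Place : Type u := Quotient (placeSetoid K)

variable {K}

/-- The class of a nontrivial absolute value. -/
def Place.mk (w : AbsoluteValue K ℝ) (hw : w.IsNontrivial) : Place K :=
  Quotient.mk (placeSetoid K) ⟨w, hw⟩

/-- A chosen representative of a place. None of the invariants below depends on the choice. -/
def Place.rep (P : Place K) : AbsoluteValue K ℝ := (Quotient.out P).1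

theorem Place.rep_isNontrivial (P : Place K) : P.rep.IsNontrivial := (Quotient.out P).2

theorem Place.mk_rep (P : Place K) : Place.mk P.rep P.rep_isNontrivial = P := Quotient.out_eq P

/-- A place is archimedean if it contains an absolute value `w` with
`w (x + y) > max (w x) (w y)` for some `x`, `y`. -/
def Place.IsArchimedean (P : Place K) : Prop :=
  ∃ (w : AbsoluteValue K ℝ) (hw : w.IsNontrivial),
    Place.mk w hw = P ∧ ∃ x y : K, max (w x) (w y) < w (x + y)

theorem Place.isNonarchimedean_rep {P : Place K} (hP : ¬ P.IsArchimedean) :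
    IsNonarchimedean P.rep := by
  intro x y
  by_contra h
  exact hP ⟨P.rep, P.rep_isNontrivial, P.mk_rep, x, y, not_le.mp h⟩

end Places

/-! ### Completions and valuation rings -/

section Local

theorem isUltrametricDist_withAbs {K : Type u} [Field K] {w : AbsoluteValue K ℝ}
    (hw : IsNonarchimedean w) : IsUltrametricDist (WithAbs w) :=
  IsUltrametricDist.isUltrametricDist_of_forall_norm_add_le_max_norm
    fun x y => hw x.ofAbs y.ofAbs

theorem isUltrametricDist_completion {K : Type u} [Field K] {w : AbsoluteValue K ℝ}
    (hw : IsNonarchimedean w) : IsUltrametricDist w.Completion := by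
  refine IsUltrametricDist.isUltrametricDist_of_forall_norm_add_le_max_norm fun x y => ?_
  induction x, y using UniformSpace.Completion.induction_on₂ with
  | hp => exact isClosed_le (by fun_prop) (by fun_prop)
  | ih a b =>
    rw [← UniformSpace.Completion.coe_add]
    simp only [UniformSpace.Completion.norm_coe]
    exact hw a.ofAbs b.ofAbs

/-- The valuation ring `{x | ‖x‖ ≤ 1}` of an ultrametric normed field. It is a local ring with
maximal ideal `{x | ‖x‖ < 1}`. -/
abbrev valuationRing (E : Type u) [NormedField E] [IsUltrametricDist E] : ValuationSubring E :=
  (NormedField.valuation (K := E)).valuationSubring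

theorem mem_valuationRing {E : Type u} [NormedField E] [IsUltrametricDist E] {x : E} :
    x ∈ valuationRing E ↔ ‖x‖ ≤ 1 := Iff.rfl

variable (E : Type u) (F : Type v) [NormedField E] [IsUltrametricDist E]
  [NormedField F] [IsUltrametricDist F] [NormedAlgebra E F]

/-- The inclusion of valuation rings induced by a normed field extension. -/
def valuationRingMap : valuationRing E →+* valuationRing F :=
  (algebraMap E F).restrict (valuationRing E) (valuationRing F) fun x hx => by
    rw [mem_valuationRing] at hx ⊢
    rwa [norm_algebraMap']

/-- The different of the valuation ring of `F` over the valuation ring of `E`: the ideal inverse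
to the dual of the valuation ring of `F` under the trace form of `F / E`. -/
def different : Ideal (valuationRing F) :=
  letI : Algebra (valuationRing E) (valuationRing F) := (valuationRingMap E F).toAlgebra
  haveI : IsScalarTower (valuationRing E) (valuationRing F) F := IsScalarTower.of_algebraMap_eq
    fun _ => rfl
  (1 / Submodule.traceDual (valuationRing E) E (1 : Submodule (valuationRing F) F)).comap
    (Algebra.linearMap (valuationRing F) F)

theorem mem_different {x : valuationRing F} :
    x ∈ different E F ↔
      ∀ y : F, (∀ b : F, ‖b‖ ≤ 1 → ‖Algebra.trace E F (y * b)‖ ≤ 1) → ‖(x : F) * y‖ ≤ 1 := by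
  simp only [different, Submodule.mem_comap, Submodule.mem_div_iff_forall_mul_mem,
    Algebra.linearMap_apply, Submodule.mem_traceDual, Submodule.mem_one, Algebra.traceForm_apply,
    RingHom.mem_range]
  refine forall_congr' fun y => ?_
  refine imp_congr ⟨fun h b hb => ?_, fun h b => ?_⟩ ⟨?_, fun h => ⟨⟨_, h⟩, rfl⟩⟩
  · obtain ⟨z, hz⟩ := h b ⟨⟨b, hb⟩, rfl⟩
    rw [← hz]
    exact z.2
  · rintro ⟨b, rfl⟩
    exact ⟨⟨_, h b b.2⟩, rfl⟩
  · rintro ⟨z, hz⟩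
    have := z.2
    change ‖(z : F)‖ ≤ 1 at this
    rwa [show (x : F) * y = z from hz.symm]

end Local

section Restriction

variable (K : Type u) {L : Type v} [Field K] [Field L] [Algebra K L]

/-- The restriction to `K` of an absolute value on an extension `L` of `K`. -/
def restrict (w : AbsoluteValue L ℝ) : AbsoluteValue K ℝ := w.comp (algebraMap K L).injective

theorem isometry_algebraMap (w : AbsoluteValue L ℝ) :
    Isometry (algebraMap (WithAbs (restrict K w)) (WithAbs w)) :=
  AddMonoidHomClass.isometry_of_norm _ fun _ => rfl

/-- The extension of completions `L̂ / K̂` induced by `L / K`, for an absolute value on `L` and its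
restriction to `K`. -/
abbrev completionNormedAlgebra (w : AbsoluteValue L ℝ) :
    NormedAlgebra (restrict K w).Completion w.Completion where
  toAlgebra := (isometry_algebraMap K w).mapRingHom.toAlgebra
  norm_smul_le x y := by
    let : Algebra (restrict K w).Completion w.Completion :=
      (isometry_algebraMap K w).mapRingHom.toAlgebra
    rw [Algebra.smul_def, norm_mul]
    refine le_of_eq (congrArg (· * ‖y‖) ?_)
    exact (isometry_algebraMap K w).completion_map.norm_map_of_map_zero
      (map_zero (isometry_algebraMap K w).mapRingHom) x

theorem isNonarchimedean_restrict {w : AbsoluteValue L ℝ} (hw : IsNonarchimedean w) :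
    IsNonarchimedean (restrict K w) := fun x y => by
  change w (algebraMap K L (x + y)) ≤ _
  rw [map_add]
  exact hw (algebraMap K L x) (algebraMap K L y)

end Restriction

/-! ### Invariants of places -/

section Invariants

open Classical in
/-- `N(P)`: for `P` archimedean, `exp (dim_ℝ K̂_P)`, where the copy of `ℝ` in `K̂_P` is the
closure of the prime field `ℚ`; for `P` nonarchimedean, the cardinality of the residue field. -/
def Place.norm {K : Type u} [Field K] (P : Place K) : ℝ :=
  if hP : P.IsArchimedean then
    Real.exp (Module.finrank (⊥ : Subfield P.rep.Completion).topologicalClosure P.rep.Completion)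
  else
    haveI := isUltrametricDist_withAbs (P.isNonarchimedean_rep hP)
    (Nat.card (IsLocalRing.ResidueField (valuationRing (WithAbs P.rep))) : ℝ)

variable (K : Type u) {L : Type v} [Field K] [Field L] [Algebra K L]

/-- `Q` lies over `P`: the restriction to `K` of an absolute value in `Q` belongs to `P`. -/
def Place.LiesOver {K : Type u} {L : Type v} [Field K] [Field L] [Algebra K L]
    (Q : Place L) (P : Place K) : Prop :=
  ∃ h : (restrict K Q.rep).IsNontrivial, Place.mk (restrict K Q.rep) h = P

open Classical in
/-- The ramification index `e_Q` of `Q` relative to `L / K`: the degree of the extension of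
completions if `Q` is archimedean, and the index of the value group of `K` in the value group
of `L` otherwise. -/
def Place.ramificationIndex (Q : Place L) : ℕ :=
  if Q.IsArchimedean then
    letI := completionNormedAlgebra K Q.rep
    Module.finrank (restrict K Q.rep).Completion Q.rep.Completion
  else
    (Units.map (restrict K Q.rep : K →* ℝ)).range.relIndex (Units.map (Q.rep : L →* ℝ)).range

open Classical in
/-- The number `r_Q` relative to `L / K`. For `Q` archimedean it is `-log log N(Q)` if `e_Q ≠ 1`,
and `0` otherwise. For `Q` nonarchimedean it is the exponent of the maximal ideal in the different
of the extension of completions at `Q`. -/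
def Place.ramificationExponent (Q : Place L) : ℝ :=
  if hQ : Q.IsArchimedean then
    if Q.ramificationIndex K ≠ 1 then -Real.log (Real.log Q.norm) else 0
  else
    haveI := isUltrametricDist_completion (Q.isNonarchimedean_rep hQ)
    haveI := isUltrametricDist_completion
      (isNonarchimedean_restrict K (Q.isNonarchimedean_rep hQ))
    letI := completionNormedAlgebra K Q.rep
    (multiplicity (IsLocalRing.maximalIdeal (valuationRing Q.rep.Completion))
      (different (restrict K Q.rep).Completion Q.rep.Completion) : ℝ)

end Invariants

/-! ### Divisors -/

section Divisors

/-- Divisors on `K`: finitely supported real coefficients on places, integral at the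
nonarchimedean places. -/
def divisors (K : Type u) [Field K] : AddSubgroup (Place K → ℝ) where
  carrier := {D | D.support.Finite ∧ ∀ P : Place K, ¬ P.IsArchimedean → ∃ n : ℤ, D P = n}
  zero_mem' := ⟨by simp, fun _ _ => ⟨0, by simp⟩⟩
  add_mem' := by
    rintro a b ⟨ha, ha'⟩ ⟨hb, hb'⟩
    refine ⟨(ha.union hb).subset (Function.support_add a b), fun P hP => ?_⟩
    obtain ⟨m, hm⟩ := ha' P hP
    obtain ⟨n, hn⟩ := hb' P hP
    exact ⟨m + n, by simp [hm, hn]⟩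
  neg_mem' := by
    rintro a ⟨ha, ha'⟩
    refine ⟨by simpa using ha, fun P hP => ?_⟩
    obtain ⟨m, hm⟩ := ha' P hP
    exact ⟨-m, by simp [hm]⟩

/-- The multiplicative degree `deg D = ∏ N(P) ^ a_P`. -/
def degree {K : Type u} [Field K] (D : divisors K) : ℝ :=
  ∏ᶠ P : Place K, P.norm ^ (D.1 P)

/-- The coefficients of the ramification divisor `R_{L/K} = ∑ r_Q · Q`. -/
def ramificationDivisor (K : Type u) (L : Type v) [Field K] [Field L] [Algebra K L] :
    Place L → ℝ := fun Q => Q.ramificationExponent K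

open Classical in
/-- The coefficients of `∑_{P ∈ S₀} 2 e_P · P`, where `S₀` is the set of places of `K` over the
place `P₀` of `K₀` and `e_P` is relative to `K / K₀`. -/
def polarDivisor {K₀ : Type u} (K : Type v) [Field K₀] [Field K] [Algebra K₀ K] (P₀ : Place K₀) :
    Place K → ℝ := fun P => if P.LiesOver P₀ then 2 * (P.ramificationIndex K₀ : ℝ) else 0

/-- The coefficients of the canonical divisor `ω'_K` of a finite separable extension `K` of
`K₀ = 𝔽_q(t)`. -/
def canonicalDivisorFunctionField {K₀ : Type u} (K : Type v) [Field K₀] [Field K] [Algebra K₀ K]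
    (P₀ : Place K₀) : Place K → ℝ :=
  ramificationDivisor K₀ K - polarDivisor K P₀

/-- The number `a_∞ = ∑_{P ∈ S₀} 2 e_P log_{N(P_∞)} N(P)`. -/
def archimedeanCoefficient {K : Type u} [Field K] [Algebra ℚ K] (P₀ : Place ℚ) (Pinf : Place K) :
    ℝ :=
  ∑ᶠ (P : Place K) (_ : P.LiesOver P₀),
    2 * (P.ramificationIndex ℚ : ℝ) * Real.logb Pinf.norm P.norm

open Classical in
/-- The coefficients of the canonical divisor `ω'_K` of a number field `K`. -/
def canonicalDivisorNumberField {K : Type u} [Field K] [Algebra ℚ K] (P₀ : Place ℚ)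
    (Pinf : Place K) : Place K → ℝ :=
  ramificationDivisor ℚ K - polarDivisor K P₀ + Pi.single Pinf (archimedeanCoefficient P₀ Pinf)

end Divisors

end GlobalField

end

noncomputable section

namespace GlobalField

universe u v

/-! ### Differents of extensions of complete fields -/

section LocalDifferent

open Module Polynomial

/-! The poles in the canonical divisors only produce a normalising factor. For a nonarchimedean
place P₀ of K₀ the fundamental identity gives the divisor ∑ 2 e_P · P over P₀ the degree
N(P₀)^(2[K:K₀]). Over ℚ the coefficient a_∞ cancels this exactly, so ω'_K has the degree of R_{K/ℚ}
for every choice of P₀ and P_∞. Over 𝔽_q(t) the factor is q^(2[K:K₀]); its [L:K]-th power is the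
factor belonging to L, by multiplicativity of degrees. In both cases it remains to show deg R_{L/K₀}
= (deg R_{K/K₀})^[L:K] · deg R_{L/K} (`finprod_ramification_tower`).

That identity holds place by place over K. Let Q lie over a nonarchimedean P, with ramification
index e and N(Q) = N(P)^f. Transitivity of the different says r_Q(L/K₀) = r_Q(L/K) + e · r_P(K/K₀),
so P contributes its local factor to the power ef, and ∑ ef = [L:K]. At an archimedean Q, log N(Q)
is the local degree over the closure of ℚ, and the same formula holds with the local degree over K
in place of ef, by inspecting the real and complex cases. The common form is `TowerFormula`;
multiplying over a finite set of places of K outside which every factor is 1 gives the theorem.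

Four ingredients carry the argument. Differents are studied through the codifferent, whose exponent
is additive in towers because the trace is transitive. Completions are linked to the global fields
by density, and every invariant is transported along equivalent absolute values, since
representatives of places are chosen arbitrarily. The fundamental identity is proved over the
discrete valuation ring of a single place, so that infinite and finite places of function fields are
treated alike. Finiteness of ramification follows from the derivative of the minimal polynomial of a
primitive element, once all but finitely many places are known to be regular for any given element
(`IsGlobal`). -/

theorem rpow_le_one_iff_of_nonneg {x c : ℝ} (hx : 0 ≤ x) (hc : 0 < c) : x ^ c ≤ 1 ↔ x ≤ 1 := by
  rw [← Real.rpow_le_rpow_iff hx zero_le_one hc, Real.one_rpow]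

/-- `π` generates the value group of the normed field `F` and has norm less than `1`. -/
structure IsUniformizer {F : Type*} [NormedField F] (π : F) : Prop where
  ne_zero : π ≠ 0
  norm_lt_one : ‖π‖ < 1
  exists_zpow : ∀ x : F, x ≠ 0 → ∃ n : ℤ, ‖x‖ = ‖π‖ ^ n

theorem IsUniformizer.norm_pos {F : Type*} [NormedField F] {π : F} (h : IsUniformizer π) :
    0 < ‖π‖ := norm_pos_iff.mpr h.ne_zero

theorem IsUniformizer.norm_le {F : Type*} [NormedField F] {π : F} (h : IsUniformizer π) {x : F}
    (hx : ‖x‖ < 1) : ‖x‖ ≤ ‖π‖ := by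
  rcases eq_or_ne x 0 with rfl | h0
  · simp
  obtain ⟨n, hn⟩ := h.exists_zpow x h0
  rw [hn] at hx ⊢
  have h1 : 0 < n := by
    by_contra hneg
    exact absurd hx (not_lt.mpr (one_le_zpow_of_nonpos₀ h.norm_pos h.norm_lt_one.le (by omega)))
  simpa using zpow_le_zpow_right_of_le_one₀ h.norm_pos h.norm_lt_one.le (show (1 : ℤ) ≤ n by omega)

theorem IsUniformizer.norm_eq {F : Type*} [NormedField F] {π π' : F} (h : IsUniformizer π)
    (h' : IsUniformizer π') : ‖π‖ = ‖π'‖ :=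
  le_antisymm (h'.norm_le h.norm_lt_one) (h.norm_le h'.norm_lt_one)

/-- The dual of the unit ball of `F` under the trace form of `F / E`. -/
def codifferent (E F : Type*) [NormedField E] [NormedField F] [Algebra E F] : Set F :=
  {y | ∀ b : F, ‖b‖ ≤ 1 → ‖Algebra.trace E F (y * b)‖ ≤ 1}

/-- The codifferent of `F / E` is the fractional ideal generated by the `-d`-th power of a
uniformizer. -/
def HasDifferentExponent (E F : Type*) [NormedField E] [NormedField F] [Algebra E F] (d : ℕ) :
    Prop :=
  ∃ π : F, IsUniformizer π ∧ ∀ y, y ∈ codifferent E F ↔ ‖y‖ * ‖π‖ ^ d ≤ 1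

theorem HasDifferentExponent.mem_iff {E F : Type*} [NormedField E] [NormedField F] [Algebra E F]
    {d : ℕ} (h : HasDifferentExponent E F d) {π : F} (hπ : IsUniformizer π) (y : F) :
    y ∈ codifferent E F ↔ ‖y‖ * ‖π‖ ^ d ≤ 1 := by
  obtain ⟨π', hπ', H⟩ := h
  rw [hπ.norm_eq hπ', H]

theorem maximalIdeal_valuationRing_eq_span {F : Type*} [NormedField F] [IsUltrametricDist F]
    {π : F} (hπ : IsUniformizer π) :
    IsLocalRing.maximalIdeal (valuationRing F) =
      Ideal.span {(⟨π, mem_valuationRing.mpr hπ.norm_lt_one.le⟩ : valuationRing F)} := by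
  ext x
  rw [Ideal.mem_span_singleton, IsLocalRing.mem_maximalIdeal, mem_nonunits_iff]
  constructor
  · intro hx
    have hx1 : ‖(x : F)‖ < 1 := by
      refine lt_of_le_of_ne x.2 fun h => hx ?_
      have h0 : (x : F) ≠ 0 := norm_ne_zero_iff.mp (by rw [h]; exact one_ne_zero)
      refine IsUnit.of_mul_eq_one
        (⟨(x : F)⁻¹, mem_valuationRing.mpr (by rw [norm_inv, h, inv_one])⟩) ?_
      exact Subtype.ext (mul_inv_cancel₀ h0)
    refine ⟨⟨(x : F) / π, mem_valuationRing.mpr ?_⟩, Subtype.ext ?_⟩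
    · rw [norm_div, div_le_one hπ.norm_pos]
      exact hπ.norm_le hx1
    · exact (mul_div_cancel₀ _ hπ.ne_zero).symm
  · rintro ⟨z, hz⟩ hu
    obtain ⟨y, hy⟩ := hu.exists_right_inv
    have h1 : (x : F) * y = 1 := congrArg Subtype.val hy
    have h2 : (x : F) = π * z := congrArg Subtype.val hz
    have h3 : ‖(x : F)‖ * ‖(y : F)‖ = 1 := by rw [← norm_mul, h1, norm_one]
    have h4 : ‖(x : F)‖ < 1 := by
      rw [h2, norm_mul]
      have hz : ‖(z : F)‖ ≤ 1 := z.2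
      nlinarith [hπ.norm_lt_one, hπ.norm_pos, norm_nonneg (z : F)]
    have h5 : ‖(y : F)‖ ≤ 1 := y.2
    nlinarith [norm_nonneg (x : F), norm_nonneg (y : F)]

theorem multiplicity_different {E F : Type*} [NormedField E] [IsUltrametricDist E]
    [NormedField F] [IsUltrametricDist F] [NormedAlgebra E F] {d : ℕ}
    (h : HasDifferentExponent E F d) :
    multiplicity (IsLocalRing.maximalIdeal (valuationRing F)) (different E F) = d := by
  obtain ⟨π, hπ, H⟩ := h
  set p : valuationRing F := ⟨π, mem_valuationRing.mpr hπ.norm_lt_one.le⟩ with hp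
  have hmem : ∀ (n : ℕ) (x : valuationRing F), x ∈ Ideal.span {p ^ n} ↔ ‖(x : F)‖ ≤ ‖π‖ ^ n := by
    intro n x
    rw [Ideal.mem_span_singleton]
    constructor
    · rintro ⟨z, rfl⟩
      have hz : ‖(z : F)‖ ≤ 1 := z.2
      change ‖π ^ n * (z : F)‖ ≤ _
      rw [norm_mul, norm_pow]
      exact mul_le_of_le_one_right (by positivity) hz
    · intro hx
      refine ⟨⟨(x : F) / π ^ n, mem_valuationRing.mpr ?_⟩, Subtype.ext ?_⟩
      · rw [norm_div, norm_pow]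
        exact div_le_one_of_le₀ hx (by positivity)
      · exact (mul_div_cancel₀ _ (pow_ne_zero n hπ.ne_zero)).symm
  have hpow : ∀ n : ℕ, IsLocalRing.maximalIdeal (valuationRing F) ^ n = Ideal.span {p ^ n} := by
    intro n
    rw [maximalIdeal_valuationRing_eq_span hπ, Ideal.span_singleton_pow]
  have hD : different E F = Ideal.span {p ^ d} := by
    ext x
    rw [mem_different, hmem]
    have hpos : 0 < ‖π‖ ^ d := pow_pos hπ.norm_pos d
    constructor
    · intro hx
      -- It suffices to test on a generator of the codifferent.
      have := hx ((π ^ d)⁻¹) ((H _).mpr (by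
        rw [norm_inv, norm_pow, inv_mul_cancel₀ hpos.ne']))
      rwa [norm_mul, norm_inv, norm_pow, ← div_eq_mul_inv, div_le_one hpos] at this
    · intro hx y hy
      rw [norm_mul, mul_comm]
      exact (mul_le_mul_of_nonneg_left hx (norm_nonneg y)).trans ((H y).mp hy)
  refine multiplicity_eq_of_dvd_of_not_dvd ?_ ?_
  · rw [hpow, hD]
  -- Failure at d + 1 also excludes infinite multiplicity, where `multiplicity` takes a default
  -- value. At the generator the inclusion would read ‖π‖ ^ d ≤ ‖π‖ ^ (d + 1).
  · intro hdvd
    have hle := Ideal.le_of_dvd hdvd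
    rw [hpow, hD] at hle
    have h1 := (hmem (d + 1) (p ^ d)).mp (hle (Ideal.mem_span_singleton_self _))
    have h2 : ‖((p ^ d : valuationRing F) : F)‖ = ‖π‖ ^ d := by
      rw [← norm_pow]; rfl
    rw [h2, pow_succ] at h1
    have hpos : 0 < ‖π‖ ^ d := pow_pos hπ.norm_pos d
    nlinarith [hπ.norm_lt_one]

/-- The exponent of the different is invariant under isomorphisms of field extensions that raise
the norm to a power. -/
theorem HasDifferentExponent.of_ringEquiv {E F E' F' : Type*} [NormedField E] [NormedField F]
    [Algebra E F] [NormedField E'] [NormedField F'] [Algebra E' F'] {d : ℕ}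
    (h : HasDifferentExponent E F d) (σ : E ≃+* E') (τ : F ≃+* F')
    (hστ : ∀ x, algebraMap E' F' (σ x) = τ (algebraMap E F x)) {c c' : ℝ} (hc : 0 < c)
    (hc' : 0 < c') (hσ : ∀ x, ‖σ x‖ = ‖x‖ ^ c') (hτ : ∀ x, ‖τ x‖ = ‖x‖ ^ c) :
    HasDifferentExponent E' F' d := by
  obtain ⟨π, hπ, H⟩ := h
  -- Only membership in unit balls matters, so the exponents on E and on F need not be related.
  have htr : ∀ x : F, ‖Algebra.trace E' F' (τ x)‖ ≤ 1 ↔ ‖Algebra.trace E F x‖ ≤ 1 := fun x => by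
    rw [Algebra.trace_eq_of_equiv_equiv σ τ (RingHom.ext hστ) x,
      ← σ.apply_symm_apply (Algebra.trace E' F' (τ x)), hσ, σ.symm_apply_apply,
      rpow_le_one_iff_of_nonneg (norm_nonneg _) hc']
  have hle : ∀ x : F, ‖τ x‖ ≤ 1 ↔ ‖x‖ ≤ 1 := fun x => by
    rw [hτ, rpow_le_one_iff_of_nonneg (norm_nonneg x) hc]
  refine ⟨τ π, ⟨by simpa using hπ.ne_zero, ?_, fun x hx => ?_⟩, fun y => ?_⟩
  · rw [hτ]; exact Real.rpow_lt_one (norm_nonneg _) hπ.norm_lt_one hc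
  · obtain ⟨n, hn⟩ := hπ.exists_zpow (τ.symm x) (by simpa using hx)
    refine ⟨n, ?_⟩
    rw [← τ.apply_symm_apply x, hτ, hτ, hn, ← Real.rpow_intCast, ← Real.rpow_intCast,
      ← Real.rpow_mul hπ.norm_pos.le, ← Real.rpow_mul hπ.norm_pos.le, mul_comm]
  · have h1 : ‖y‖ * ‖τ π‖ ^ d = ‖τ (τ.symm y * π ^ d)‖ := by simp
    rw [h1, hle, norm_mul, norm_pow, ← H]
    constructor
    · intro hy b hb
      rw [← htr, map_mul, τ.apply_symm_apply]
      exact hy (τ b) ((hle b).mpr hb)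
    · intro hy b hb
      have := hy (τ.symm b) (by rwa [← hle, τ.apply_symm_apply])
      rwa [← htr, map_mul, τ.apply_symm_apply, τ.apply_symm_apply] at this

/-- By transitivity of the trace, y lies in the codifferent of G/E exactly when the traces to F of y
times the unit ball of G lie in the codifferent of F/E, the ideal generated by π ^ (-d₁). By
F-linearity this says that π ^ d₁ · y is in the codifferent of G/F. -/
theorem HasDifferentExponent.tower {E F G : Type*} [NormedField E] [NormedField F] [NormedField G]
    [Algebra E F] [NormedAlgebra F G] [Algebra E G] [IsScalarTower E F G] [FiniteDimensional E F]
    [FiniteDimensional F G] {d₁ d₂ e : ℕ} (h₁ : HasDifferentExponent E F d₁)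
    (h₂ : HasDifferentExponent F G d₂) {π : F} {ϖ : G} (hπ : IsUniformizer π)
    (hϖ : IsUniformizer ϖ) (he : ‖π‖ = ‖ϖ‖ ^ e) :
    HasDifferentExponent E G (d₂ + e * d₁) := by
  refine ⟨ϖ, hϖ, fun y => ?_⟩
  have key : y ∈ codifferent E G ↔ algebraMap F G (π ^ d₁) * y ∈ codifferent F G := by
    have h3 : ∀ b : G, Algebra.trace F G (algebraMap F G (π ^ d₁) * y * b) =
        π ^ d₁ * Algebra.trace F G (y * b) := fun b => by
      rw [mul_assoc, ← Algebra.smul_def, map_smul, smul_eq_mul]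
    have h4 : algebraMap F G (π ^ d₁) * y ∈ codifferent F G ↔
        ∀ b : G, ‖b‖ ≤ 1 → Algebra.trace F G (y * b) ∈ codifferent E F := by
      refine forall₂_congr fun b _ => ?_
      rw [h3, h₁.mem_iff hπ, norm_mul, norm_pow, mul_comm]
    rw [h4]
    constructor
    -- The unit ball of G is stable under that of F, so b' can be moved inside the trace to F.
    · intro hy b hb b' hb'
      have := hy (algebraMap F G b' * b) (by
        rw [norm_mul, norm_algebraMap']; exact mul_le_one₀ hb' (norm_nonneg _) hb)
      rwa [← Algebra.trace_trace (S := F), mul_left_comm, ← Algebra.smul_def, map_smul,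
        smul_eq_mul, mul_comm] at this
    · intro hy b hb
      have := hy b hb 1 (by simp)
      rwa [mul_one, Algebra.trace_trace] at this
  rw [key, h₂.mem_iff hϖ, norm_mul, norm_algebraMap', norm_pow, he, ← pow_mul, pow_add]
  ring_nf

/-- Scale a basis into the unit ball. The coordinates of y in the trace-dual basis, which exists by
separability, are traces of y times basis vectors and are therefore bounded. -/
theorem exists_norm_le_of_mem_codifferent {E F : Type*} [NontriviallyNormedField E]
    [NormedField F] [NormedAlgebra E F] [FiniteDimensional E F] [Algebra.IsSeparable E F] :
    ∃ M : ℝ, ∀ y ∈ codifferent E F, ‖y‖ ≤ M := by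
  let b := Module.finBasis E F
  have hc : ∀ i, ∃ c : E, c ≠ 0 ∧ ‖c • b i‖ ≤ 1 := fun i => by
    obtain ⟨c, hc0, hc⟩ := NormedField.exists_norm_lt E
      (r := ‖b i‖⁻¹) (inv_pos.mpr (norm_pos_iff.mpr (b.ne_zero i)))
    refine ⟨c, norm_pos_iff.mp hc0, ?_⟩
    rw [norm_smul]
    exact by
      rw [← one_div, lt_div_iff₀ (norm_pos_iff.mpr (b.ne_zero i))] at hc
      exact hc.le
  choose c hc0 hc using hc
  refine ⟨∑ i, ‖c i‖⁻¹ * ‖b.traceDual i‖, fun y hy => ?_⟩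
  rw [← b.traceDual.sum_repr y]
  refine (norm_sum_le _ _).trans (Finset.sum_le_sum fun i _ => ?_)
  rw [norm_smul, b.traceDual_repr_apply, Algebra.traceForm_apply]
  refine mul_le_mul_of_nonneg_right ?_ (norm_nonneg _)
  have h1 := hy (c i • b i) (hc i)
  rw [mul_smul_comm, map_smul, norm_smul] at h1
  rw [← one_div, le_div_iff₀ (norm_pos_iff.mpr (hc0 i)), mul_comm]
  exact h1

/-! ### Complete base fields: existence and vanishing of the different exponent -/

section Complete

variable {E F : Type*} [NontriviallyNormedField E] [CompleteSpace E] [IsUltrametricDist E]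
  [NormedField F] [NormedAlgebra E F] [FiniteDimensional E F]

/-- Over a complete ultrametric field the norm of a finite extension is the spectral norm, which is
computed from the coefficients of the minimal polynomial. -/
theorem norm_coeff_minpoly_le_one {x : F} (hx : ‖x‖ ≤ 1) (n : ℕ) :
    ‖(minpoly E x).coeff n‖ ≤ 1 := by
  rw [NormedAlgebra.norm_eq_spectralNorm E x] at hx
  exact (spectralValue_le_one_iff (minpoly.monic (Algebra.IsIntegral.isIntegral x))).mp hx n

theorem norm_trace_le_one {x : F} (hx : ‖x‖ ≤ 1) : ‖Algebra.trace E F x‖ ≤ 1 := by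
  rw [trace_eq_finrank_mul_minpoly_nextCoeff, norm_mul, norm_neg]
  refine mul_le_one₀ (IsUltrametricDist.norm_natCast_le_one E _) (norm_nonneg _) ?_
  rw [nextCoeff]
  split_ifs
  · simp
  · exact norm_coeff_minpoly_le_one hx _

theorem mem_codifferent_of_norm_le_one {y : F} (hy : ‖y‖ ≤ 1) : y ∈ codifferent E F :=
  fun b hb => norm_trace_le_one (by rw [norm_mul]; exact mul_le_one₀ hy (norm_nonneg _) hb)

/-- The codifferent is stable under the unit ball, contains it, and is bounded. As the value group
is generated by ‖π‖, the codifferent is generated by π ^ (-d) with d the largest n for which π ^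
(-n) belongs to it. -/
theorem exists_hasDifferentExponent [Algebra.IsSeparable E F] {π : F} (hπ : IsUniformizer π) :
    ∃ d, HasDifferentExponent E F d := by
  classical
  obtain ⟨M, hM⟩ := exists_norm_le_of_mem_codifferent (E := E) (F := F)
  obtain ⟨N, hN⟩ := exists_pow_lt_of_lt_one (show 0 < (max M 1)⁻¹ by positivity) hπ.norm_lt_one
  have hbound : ∀ n : ℕ, (π ^ n)⁻¹ ∈ codifferent E F → n ≤ N := fun n hn => by
    by_contra hlt
    have h1 := hM _ hn
    rw [norm_inv, norm_pow] at h1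
    have h2 : ‖π‖ ^ n ≤ ‖π‖ ^ N := pow_le_pow_of_le_one hπ.norm_pos.le hπ.norm_lt_one.le (by omega)
    have h3 : max M 1 < (‖π‖ ^ n)⁻¹ := by
      rw [lt_inv_comm₀ (by positivity) (pow_pos hπ.norm_pos n)]
      exact h2.trans_lt hN
    exact absurd (h1.trans (le_max_left _ 1)) (not_le.mpr h3)
  set d := Nat.findGreatest (fun n => (π ^ n)⁻¹ ∈ codifferent E F) N
  have hd : (π ^ d)⁻¹ ∈ codifferent E F :=
    Nat.findGreatest_spec (P := fun n => (π ^ n)⁻¹ ∈ codifferent E F) (Nat.zero_le N)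
      (by simpa using mem_codifferent_of_norm_le_one (E := E) (y := (1 : F)) (by simp))
  have hmul : ∀ y z : F, y ∈ codifferent E F → ‖z‖ ≤ ‖y‖ → z ∈ codifferent E F := by
    intro y z hy hzy b hb
    rcases eq_or_ne y 0 with rfl | hy0
    · have : z = 0 := by simpa using hzy
      simp [this]
    have := hy (z / y * b) (by
      rw [norm_mul, norm_div]
      exact mul_le_one₀ (div_le_one_of_le₀ hzy (norm_nonneg _)) (norm_nonneg _) hb)
    rwa [← mul_assoc, mul_div_cancel₀ _ hy0] at this
  refine ⟨d, π, hπ, fun y => ?_⟩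
  have hpos : 0 < ‖π‖ ^ d := pow_pos hπ.norm_pos d
  constructor
  · intro hy
    by_contra hlt
    rw [not_le] at hlt
    have hy0 : y ≠ 0 := by rintro rfl; simp at hlt; linarith
    obtain ⟨n, hn⟩ := hπ.exists_zpow y hy0
    rw [hn, ← zpow_natCast, ← zpow_add₀ hπ.norm_pos.ne'] at hlt
    have hneg : n + d < 0 := by
      by_contra hge
      exact absurd hlt (not_lt.mpr (zpow_le_one₀ hπ.norm_pos
        hπ.norm_lt_one.le (by omega)))
    obtain ⟨m, rfl⟩ : ∃ m : ℕ, n = -(m : ℤ) := ⟨n.natAbs, by omega⟩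
    have hmem : (π ^ m)⁻¹ ∈ codifferent E F := hmul y _ hy (by
      rw [hn, norm_inv, norm_pow, zpow_neg, zpow_natCast])
    have := Nat.le_findGreatest (P := fun n => (π ^ n)⁻¹ ∈ codifferent E F) (hbound m hmem) hmem
    change m ≤ d at this
    omega
  · intro hy
    refine hmul _ y hd ?_
    rw [norm_inv, norm_pow, ← one_div, le_div_iff₀ hpos]
    exact hy

/-- If `F = E(α)` with `α` integral and `g'(α)` a unit, where `g` is the minimal polynomial of `α`,
then the different of `F / E` is trivial. -/
theorem HasDifferentExponent.eq_zero [Algebra.IsSeparable E F] [IsUltrametricDist F] {d : ℕ}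
    (h : HasDifferentExponent E F d) {α : F} (hα : ‖α‖ ≤ 1) (htop : Algebra.adjoin E {α} = ⊤)
    (hderiv : ‖aeval α (derivative (minpoly E α))‖ = 1) : d = 0 := by
  obtain ⟨π, hπ, H⟩ := h
  have hint : IsIntegral E α := Algebra.IsIntegral.isIntegral α
  let pb : PowerBasis E F := PowerBasis.ofAdjoinEqTop hint htop
  have hgen : pb.gen = α := PowerBasis.ofAdjoinEqTop_gen hint htop
  -- The coefficients of g / (X - α) satisfy a descending recursion whose terms are coefficients of
  -- g and multiples of α. The index k measures the distance from the top degree, where the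
  -- coefficients vanish.
  have hcoeff : ∀ k i, (minpoly E α).natDegree ≤ i + k → ‖(minpolyDiv E α).coeff i‖ ≤ 1 := by
    intro k
    induction k with
    | zero =>
      intro i hi
      rw [add_zero] at hi
      rw [coeff_eq_zero_of_natDegree_lt ((natDegree_minpolyDiv_lt hint).trans_le hi), norm_zero]
      exact zero_le_one
    | succ k ih =>
      intro i hi
      rw [coeff_minpolyDiv]
      refine (IsUltrametricDist.norm_add_le_max _ _).trans (max_le ?_ ?_)
      · rw [norm_algebraMap']; exact norm_coeff_minpoly_le_one hα _
      · rw [norm_mul]; exact mul_le_one₀ (ih _ (by omega)) (norm_nonneg _) hα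
  -- Euler: the basis dual to the powers of α consists of the coefficients of g / (X - α) divided by
  -- g'(α), a unit here.
  have hdual : ∀ i, ‖pb.basis.traceDual i‖ ≤ 1 := fun i => by
    rw [Module.Basis.traceDual_powerBasis_eq, hgen, norm_div, hderiv, div_one]
    exact hcoeff _ _ (Nat.le_add_left _ _)
  by_contra hd
  -- If d were positive, π⁻¹ would lie in the codifferent; its expansion in the integral dual basis
  -- has integral coordinates, forcing ‖π⁻¹‖ ≤ 1.
  have hmem : π⁻¹ ∈ codifferent E F := by
    rw [H, norm_inv]
    calc ‖π‖⁻¹ * ‖π‖ ^ d ≤ ‖π‖⁻¹ * ‖π‖ ^ 1 :=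
          mul_le_mul_of_nonneg_left (pow_le_pow_of_le_one hπ.norm_pos.le hπ.norm_lt_one.le
            (by omega)) (by positivity)
      _ = 1 := by rw [pow_one, inv_mul_cancel₀ hπ.norm_pos.ne']
  have hle : ‖π⁻¹‖ ≤ 1 := by
    rw [← pb.basis.traceDual.sum_repr π⁻¹]
    refine IsUltrametricDist.norm_sum_le_of_forall_le_of_nonneg zero_le_one fun i _ => ?_
    rw [norm_smul, pb.basis.traceDual_repr_apply, Algebra.traceForm_apply]
    refine mul_le_one₀ (hmem _ ?_) (norm_nonneg _) (hdual i)
    rw [pb.basis_eq_pow, hgen, norm_pow]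
    exact pow_le_one₀ (norm_nonneg _) hα
  rw [norm_inv] at hle
  exact absurd hle (not_le.mpr (one_lt_inv₀ hπ.norm_pos |>.mpr hπ.norm_lt_one))

end Complete

end LocalDifferent

/-! ### Extensions of completions -/

section Completions

open Polynomial UniformSpace

variable {K : Type u} {L : Type v} [Field K] [Field L] [Algebra K L]

/-- The embedding of a field in its completion. -/
def toCompletion (w : AbsoluteValue K ℝ) : K →+* w.Completion :=
  Completion.coeRingHom.comp (WithAbs.equiv w).symm.toRingHom

theorem norm_toCompletion (w : AbsoluteValue K ℝ) (x : K) : ‖toCompletion w x‖ = w x :=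
  Completion.norm_coe _

theorem denseRange_toCompletion (w : AbsoluteValue K ℝ) : DenseRange (toCompletion w) :=
  Completion.denseRange_coe.comp (WithAbs.equiv w).symm.surjective.denseRange
    (Completion.continuous_coe _)

/-- Completions at equivalent absolute values are isomorphic. -/
theorem exists_completion_ringEquiv {w w' : AbsoluteValue K ℝ} (h : w.IsEquiv w') :
    ∃ (σ : w.Completion ≃+* w'.Completion) (c : ℝ), 0 < c ∧ Continuous σ ∧
      (∀ x, σ (toCompletion w x) = toCompletion w' x) ∧ ∀ x, ‖σ x‖ = ‖x‖ ^ c := by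
  obtain ⟨c, hc, hcw⟩ := AbsoluteValue.isEquiv_iff_exists_rpow_eq.mp h
  have h1 : Continuous (WithAbs.congr w w' (.refl K)) := h.isEmbedding_equivWithAbs.continuous
  have h2 : Continuous (WithAbs.congr w w' (.refl K)).symm :=
    h.symm.isEmbedding_equivWithAbs.continuous
  let σ := Completion.mapRingEquiv (WithAbs.congr w w' (.refl K)) h1 h2
  have hσ : Continuous σ := Completion.continuous_map
  have hcoe : ∀ x, σ (toCompletion w x) = toCompletion w' x := fun x =>
    Completion.map_coe (uniformContinuous_addMonoidHom_of_continuous h1) _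
  refine ⟨σ, c, hc, hσ, hcoe, fun x => ?_⟩
  refine (denseRange_toCompletion w).induction_on
    (p := fun x => ‖σ x‖ = ‖x‖ ^ c) x ?_ fun a => ?_
  · exact isClosed_eq hσ.norm (continuous_norm.rpow_const fun _ => .inr hc.le)
  · rw [hcoe, norm_toCompletion, norm_toCompletion]
    exact (congrFun hcw a).symm

theorem restrict_isEquiv {w w' : AbsoluteValue L ℝ} (h : w.IsEquiv w') :
    (restrict K w).IsEquiv (restrict K w') := fun _ _ => h _ _

theorem restrict_restrict {M : Type*} [Field M] [Algebra K M] [Algebra L M] [IsScalarTower K L M]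
    (w : AbsoluteValue M ℝ) : restrict K (restrict L w) = restrict K w := by
  ext x
  exact congrArg w (IsScalarTower.algebraMap_apply K L M x).symm

section

variable (K) (w : AbsoluteValue L ℝ)

theorem algebraMap_toCompletion (x : K) :
    letI := completionNormedAlgebra K w
    algebraMap (restrict K w).Completion w.Completion (toCompletion (restrict K w) x) =
      toCompletion w (algebraMap K L x) :=
  Completion.map_coe (isometry_algebraMap K w).uniformContinuous _

theorem continuous_algebraMap_completion :
    letI := completionNormedAlgebra K w
    Continuous (algebraMap (restrict K w).Completion w.Completion) :=
  Completion.continuous_map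

/-- The exponent of the different of the completion of `L` at `w` over the closure of `K`. -/
def HasDifferentExponentAt (d : ℕ) : Prop :=
  letI := completionNormedAlgebra K w
  HasDifferentExponent (restrict K w).Completion w.Completion d

variable {K w}

/-- Isomorphisms of completions are compatible with field extensions. -/
theorem algebraMap_completion_comm {w' : AbsoluteValue L ℝ}
    {σ : (restrict K w).Completion ≃+* (restrict K w').Completion}
    {τ : w.Completion ≃+* w'.Completion} (hσc : Continuous σ) (hτc : Continuous τ)
    (hσ : ∀ x, σ (toCompletion (restrict K w) x) = toCompletion (restrict K w') x)
    (hτ : ∀ x, τ (toCompletion w x) = toCompletion w' x) (x : (restrict K w).Completion) :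
    letI := completionNormedAlgebra K w
    letI := completionNormedAlgebra K w'
    algebraMap (restrict K w').Completion w'.Completion (σ x) =
      τ (algebraMap (restrict K w).Completion w.Completion x) := by
  refine (denseRange_toCompletion (restrict K w)).induction_on x ?_ fun a => ?_
  · exact isClosed_eq ((continuous_algebraMap_completion K w').comp hσc)
      (hτc.comp (continuous_algebraMap_completion K w))
  · rw [hσ, algebraMap_toCompletion, algebraMap_toCompletion, hτ]

/-- Needed because the representative of the place below Q is only equivalent to the restriction of
the representative of Q. -/
theorem HasDifferentExponentAt.of_isEquiv {w' : AbsoluteValue L ℝ} {d : ℕ}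
    (hd : HasDifferentExponentAt K w d) (h : w.IsEquiv w') : HasDifferentExponentAt K w' d := by
  obtain ⟨σ, c', hc', hσc, hσ, hσn⟩ := exists_completion_ringEquiv (restrict_isEquiv (K := K) h)
  obtain ⟨τ, c, hc, hτc, hτ, hτn⟩ := exists_completion_ringEquiv h
  let := completionNormedAlgebra K w
  let := completionNormedAlgebra K w'
  exact HasDifferentExponent.of_ringEquiv hd σ τ (algebraMap_completion_comm hσc hτc hσ hτ)
    hc hc' hσn hτn

theorem finrank_completion_of_isEquiv {w' : AbsoluteValue L ℝ} (h : w.IsEquiv w') :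
    @Module.finrank (restrict K w).Completion w.Completion _ _
      (completionNormedAlgebra K w).toModule =
    @Module.finrank (restrict K w').Completion w'.Completion _ _
      (completionNormedAlgebra K w').toModule := by
  obtain ⟨σ, c', hc', hσc, hσ, hσn⟩ := exists_completion_ringEquiv (restrict_isEquiv (K := K) h)
  obtain ⟨τ, c, hc, hτc, hτ, hτn⟩ := exists_completion_ringEquiv h
  let := completionNormedAlgebra K w
  let := completionNormedAlgebra K w'
  exact Algebra.finrank_eq_of_equiv_equiv σ τ
    (RingHom.ext (algebraMap_completion_comm hσc hτc hσ hτ))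

end

/-- A nontrivially normed field structure on the completion. -/
abbrev completionNontriviallyNormedField {w : AbsoluteValue K ℝ} (hw : w.IsNontrivial) :
    NontriviallyNormedField w.Completion where
  toNormedField := inferInstance
  non_trivial := by
    obtain ⟨x, hx⟩ := hw.exists_abv_gt_one
    exact ⟨toCompletion w x, by rwa [norm_toCompletion]⟩

theorem aeval_toCompletion {w : AbsoluteValue L ℝ} (f : K[X]) (x : L) :
    letI := completionNormedAlgebra K w
    aeval (toCompletion w x) (f.map (toCompletion (restrict K w))) =
      toCompletion w (aeval x f) := by
  let := completionNormedAlgebra K w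
  rw [aeval_def, eval₂_map, aeval_def, hom_eval₂]
  congr 1
  ext y
  exact algebraMap_toCompletion K w y

theorem isIntegral_toCompletion [Algebra.IsIntegral K L] {w : AbsoluteValue L ℝ} (x : L) :
    letI := completionNormedAlgebra K w
    IsIntegral (restrict K w).Completion (toCompletion w x) := by
  let := completionNormedAlgebra K w
  refine ⟨(minpoly K x).map (toCompletion (restrict K w)),
    (minpoly.monic (Algebra.IsIntegral.isIntegral x)).map _, ?_⟩
  have := aeval_toCompletion (w := w) (minpoly K x) x
  rwa [minpoly.aeval, map_zero] at this

theorem exists_adjoin_eq_top (K : Type u) (L : Type v) [Field K] [Field L] [Algebra K L]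
    [FiniteDimensional K L] [Algebra.IsSeparable K L] : ∃ α : L, Algebra.adjoin K {α} = ⊤ := by
  obtain ⟨α, hα⟩ := Field.exists_primitive_element K L
  refine ⟨α, ?_⟩
  rw [← IntermediateField.adjoin_simple_toSubalgebra_of_isAlgebraic
    (Algebra.IsAlgebraic.isAlgebraic α), hα, IntermediateField.top_toSubalgebra]

/-! ### Finiteness and separability of the extension of completions -/

section FiniteSeparable

variable [Algebra.IsSeparable K L] {w : AbsoluteValue L ℝ}

/-- The algebra generated by α is finite-dimensional over a complete field, hence closed, and it
contains the dense image of L. -/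
theorem adjoin_toCompletion_eq_top (hw : (restrict K w).IsNontrivial) {α : L}
    (hα : Algebra.adjoin K {α} = ⊤) :
    letI := completionNormedAlgebra K w
    Algebra.adjoin (restrict K w).Completion {toCompletion w α} = ⊤ := by
  let := completionNormedAlgebra K w
  let := completionNontriviallyNormedField hw
  set S := Algebra.adjoin (restrict K w).Completion {toCompletion w α}
  have hfin : FiniteDimensional (restrict K w).Completion (Subalgebra.toSubmodule S) :=
    Module.Finite.iff_fg.mpr (isIntegral_toCompletion α).fg_adjoin_singleton
  have hclosed : IsClosed (S : Set w.Completion) :=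
    (Subalgebra.toSubmodule S).closed_of_finiteDimensional
  have hL : ∀ x : L, toCompletion w x ∈ S := by
    intro x
    have hx : x ∈ Algebra.adjoin K {α} := hα ▸ Algebra.mem_top
    obtain ⟨f, rfl⟩ := Algebra.adjoin_singleton_eq_range_aeval K α ▸ hx
    change toCompletion w (aeval α f) ∈ S
    rw [← aeval_toCompletion]
    exact aeval_mem_adjoin_singleton _ _
  refine Algebra.eq_top_iff.mpr fun x => ?_
  have := (denseRange_toCompletion w).closure_range ▸ Set.mem_univ x
  exact closure_minimal (Set.range_subset_iff.mpr hL) hclosed this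

variable [FiniteDimensional K L]

theorem finiteDimensional_completion (hw : (restrict K w).IsNontrivial) :
    letI := completionNormedAlgebra K w
    FiniteDimensional (restrict K w).Completion w.Completion := by
  let := completionNormedAlgebra K w
  obtain ⟨α, hα⟩ := exists_adjoin_eq_top K L
  have h := (isIntegral_toCompletion (K := K) (w := w) α).fg_adjoin_singleton
  rw [adjoin_toCompletion_eq_top hw hα] at h
  exact ⟨h⟩

/-- The minimal polynomial of a primitive element over the completion divides the image of its
separable minimal polynomial over K. -/
theorem isSeparable_completion (hw : (restrict K w).IsNontrivial) :
    letI := completionNormedAlgebra K w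
    Algebra.IsSeparable (restrict K w).Completion w.Completion := by
  let := completionNormedAlgebra K w
  obtain ⟨α, hα⟩ := exists_adjoin_eq_top K L
  have hsep : IsSeparable (restrict K w).Completion (toCompletion w α) := by
    have h := Separable.map (f := toCompletion (restrict K w))
      (Algebra.IsSeparable.isSeparable K α : (minpoly K α).Separable)
    refine h.of_dvd (minpoly.dvd _ _ ?_)
    rw [aeval_toCompletion, minpoly.aeval, map_zero]
  have htop : IntermediateField.adjoin (restrict K w).Completion {toCompletion w α} = ⊤ := by
    refine top_le_iff.mp fun x _ => ?_
    have hx : x ∈ Algebra.adjoin (restrict K w).Completion {toCompletion w α} :=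
      adjoin_toCompletion_eq_top hw hα ▸ Algebra.mem_top
    exact IntermediateField.algebra_adjoin_le_adjoin _ _ hx
  have h1 := (IntermediateField.isSeparable_adjoin_simple_iff_isSeparable _ _).mpr hsep
  rw [htop] at h1
  exact (IntermediateField.isSeparable_top _ _).mp h1

end FiniteSeparable

end Completions

/-! ### The different exponent of a discrete absolute value -/

section DiscreteAbsoluteValue

open Polynomial

/-- `π` generates the value group of `w` and `w π < 1`. -/
structure IsUniformizerAt {K : Type*} [Field K] (w : AbsoluteValue K ℝ) (π : K) : Prop where
  ne_zero : π ≠ 0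
  lt_one : w π < 1
  exists_zpow : ∀ x : K, x ≠ 0 → ∃ n : ℤ, w x = w π ^ n

theorem IsUniformizerAt.pos {K : Type*} [Field K] {w : AbsoluteValue K ℝ} {π : K}
    (h : IsUniformizerAt w π) : 0 < w π := w.pos h.ne_zero

theorem IsUniformizerAt.isNontrivial {K : Type*} [Field K] {w : AbsoluteValue K ℝ} {π : K}
    (h : IsUniformizerAt w π) : w.IsNontrivial := ⟨π, h.ne_zero, h.lt_one.ne⟩

theorem IsUniformizerAt.of_isEquiv {K : Type*} [Field K] {w w' : AbsoluteValue K ℝ} {π : K}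
    (h : IsUniformizerAt w π) (hw : w.IsEquiv w') : IsUniformizerAt w' π := by
  obtain ⟨c, hc, hcw⟩ := AbsoluteValue.isEquiv_iff_exists_rpow_eq.mp hw
  have hcw : ∀ x, w' x = w x ^ c := fun x => (congrFun hcw x).symm
  refine ⟨h.ne_zero, hw.lt_one_iff.mp h.lt_one, fun x hx => ?_⟩
  obtain ⟨n, hn⟩ := h.exists_zpow x hx
  refine ⟨n, ?_⟩
  rw [hcw, hcw, hn, ← Real.rpow_intCast, ← Real.rpow_intCast, ← Real.rpow_mul h.pos.le,
    ← Real.rpow_mul h.pos.le, mul_comm]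

/-- Completing does not enlarge the value group: by the ultrametric inequality, an element of K
closer to x than ‖x‖ has the same norm as x. -/
theorem IsUniformizerAt.toCompletion {K : Type*} [Field K] {w : AbsoluteValue K ℝ} {π : K}
    (h : IsUniformizerAt w π) (hw : IsNonarchimedean w) : IsUniformizer (toCompletion w π) := by
  have := isUltrametricDist_completion hw
  refine ⟨(_root_.map_ne_zero _).mpr h.ne_zero, by rw [norm_toCompletion]; exact h.lt_one, fun x hx => ?_⟩
  obtain ⟨a, ha⟩ := (denseRange_toCompletion w).exists_dist_lt x (norm_pos_iff.mpr hx)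
  have hxa : ‖x‖ = w a := by
    rw [← norm_toCompletion w a]
    rw [dist_eq_norm] at ha
    set b := GlobalField.toCompletion w a
    have h1 := IsUltrametricDist.norm_add_le_max (x - b) b
    have h2 := IsUltrametricDist.norm_add_le_max x (b - x)
    rw [sub_add_cancel] at h1
    rw [add_sub_cancel, norm_sub_rev, max_eq_left ha.le] at h2
    refine le_antisymm ?_ h2
    rcases le_max_iff.mp h1 with h | h
    · exact absurd ha (not_lt.mpr h)
    · exact h
  have ha0 : a ≠ 0 := by
    rintro rfl
    rw [map_zero, norm_eq_zero] at hxa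
    exact hx hxa
  rw [hxa, norm_toCompletion]
  exact h.exists_zpow a ha0

/-- If ‖x‖ > 1, the leading term would have strictly larger norm than the sum of all the others. -/
theorem norm_le_one_of_eval_eq_zero {F : Type*} [NormedField F] [IsUltrametricDist F] {p : F[X]}
    (hp : p.Monic) (hcoeff : ∀ i, ‖p.coeff i‖ ≤ 1) {x : F} (hx : p.eval x = 0) : ‖x‖ ≤ 1 := by
  by_contra hlt
  rw [not_le] at hlt
  have hdeg : p.natDegree ≠ 0 := fun h => by
    rw [hp.natDegree_eq_zero.mp h] at hx; simp at hx
  have h1 := congrArg (eval x) hp.as_sum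
  rw [hx, eval_add, eval_pow, eval_X, eval_finsetSum] at h1
  have h2 : ‖x ^ p.natDegree‖ ≤ ‖x‖ ^ (p.natDegree - 1) := by
    rw [eq_neg_of_add_eq_zero_left h1.symm, norm_neg]
    refine IsUltrametricDist.norm_sum_le_of_forall_le_of_nonneg (by positivity) fun i hi => ?_
    rw [eval_mul, eval_C, eval_pow, eval_X, norm_mul, norm_pow]
    refine (mul_le_of_le_one_left (by positivity) (hcoeff i)).trans ?_
    exact pow_le_pow_right₀ hlt.le (by have := Finset.mem_range.mp hi; omega)
  rw [norm_pow] at h2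
  exact absurd h2 (not_le.mpr (pow_lt_pow_right₀ hlt (by omega)))

theorem norm_eval_le_one {F : Type*} [NormedField F] [IsUltrametricDist F] {p : F[X]}
    (hcoeff : ∀ i, ‖p.coeff i‖ ≤ 1) {x : F} (hx : ‖x‖ ≤ 1) : ‖p.eval x‖ ≤ 1 := by
  rw [eval_eq_sum_range]
  refine IsUltrametricDist.norm_sum_le_of_forall_le_of_nonneg zero_le_one fun i _ => ?_
  rw [norm_mul, norm_pow]
  exact mul_le_one₀ (hcoeff i) (by positivity) (pow_le_one₀ (norm_nonneg _) hx)

/-- Divisibility by a monic polynomial descends to the valuation ring, so the quotient has integral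
coefficients. -/
theorem norm_coeff_le_one_of_mul {E : Type*} [NormedField E] [IsUltrametricDist E] {f g h : E[X]}
    (hg : g.Monic) (hfc : ∀ i, ‖f.coeff i‖ ≤ 1) (hgc : ∀ i, ‖g.coeff i‖ ≤ 1) (hfgh : f = g * h)
    (i : ℕ) : ‖h.coeff i‖ ≤ 1 := by
  have hlift : ∀ p : E[X], (∀ i, ‖p.coeff i‖ ≤ 1) → p ∈ lifts (valuationRing E).subtype :=
    fun p hp => (lifts_iff_coeff_lifts p).mpr fun n => ⟨⟨p.coeff n, hp n⟩, rfl⟩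
  obtain ⟨P, hP⟩ := (mem_lifts f).mp (hlift f hfc)
  obtain ⟨G, hG, -, hGm⟩ := lifts_and_natDegree_eq_and_monic (hlift g hgc) hg
  obtain ⟨H, rfl⟩ := (map_dvd_map (valuationRing E).subtype Subtype.val_injective hGm).mp
    (show G.map _ ∣ P.map _ by rw [hG, hP]; exact ⟨h, hfgh⟩)
  have hH : h = H.map (valuationRing E).subtype := by
    refine mul_left_cancel₀ hg.ne_zero ?_
    rw [← hfgh, ← hP, Polynomial.map_mul, hG]
  rw [hH, coeff_map]
  exact (H.coeff i).2

/-! ### Existence, transitivity and vanishing of different exponents for absolute values -/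

section Tower

variable {K : Type*} {L : Type*} {M : Type*} [Field K] [Field L] [Field M] [Algebra K L]
  [Algebra L M] [Algebra K M] [IsScalarTower K L M]

theorem exists_hasDifferentExponentAt [FiniteDimensional K L] [Algebra.IsSeparable K L]
    {w : AbsoluteValue L ℝ} (hw : IsNonarchimedean w) (hK : (restrict K w).IsNontrivial) {π : L}
    (hπ : IsUniformizerAt w π) : ∃ d, HasDifferentExponentAt K w d := by
  have := isUltrametricDist_completion (isNonarchimedean_restrict K hw)
  let := completionNormedAlgebra K w
  let := completionNontriviallyNormedField hK
  have := finiteDimensional_completion hK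
  have := isSeparable_completion hK
  exact exists_hasDifferentExponent (hπ.toCompletion hw)

theorem ramificationExponent_eq {Q : Place L} (hQ : ¬ Q.IsArchimedean) {d : ℕ}
    (h : HasDifferentExponentAt K Q.rep d) : Q.ramificationExponent K = d := by
  have := isUltrametricDist_completion (Q.isNonarchimedean_rep hQ)
  have := isUltrametricDist_completion (isNonarchimedean_restrict K (Q.isNonarchimedean_rep hQ))
  let := completionNormedAlgebra K Q.rep
  rw [Place.ramificationExponent, dif_neg hQ]
  exact congrArg Nat.cast (multiplicity_different h)

theorem HasDifferentExponentAt.tower [FiniteDimensional K L] [Algebra.IsSeparable K L]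
    [FiniteDimensional L M] [Algebra.IsSeparable L M] {w : AbsoluteValue M ℝ}
    (hw : IsNonarchimedean w) (hK : (restrict K w).IsNontrivial) {d₁ d₂ e : ℕ}
    (h₁ : HasDifferentExponentAt K (restrict L w) d₁) (h₂ : HasDifferentExponentAt L w d₂)
    {π : L} {ϖ : M} (hπ : IsUniformizerAt (restrict L w) π) (hϖ : IsUniformizerAt w ϖ)
    (he : w (algebraMap L M π) = w ϖ ^ e) : HasDifferentExponentAt K w (d₂ + e * d₁) := by
  have hKL : (restrict K (restrict L w)).IsNontrivial := by rwa [restrict_restrict]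
  have hLM := hπ.isNontrivial
  let := completionNormedAlgebra K (restrict L w)
  let := completionNormedAlgebra L w
  have := finiteDimensional_completion hKL
  have := finiteDimensional_completion hLM
  let : Algebra (restrict K (restrict L w)).Completion w.Completion :=
    ((algebraMap (restrict L w).Completion w.Completion).comp
      (algebraMap (restrict K (restrict L w)).Completion (restrict L w).Completion)).toAlgebra
  have : IsScalarTower (restrict K (restrict L w)).Completion (restrict L w).Completion
    w.Completion := IsScalarTower.of_algebraMap_eq fun _ => rfl
  have key := HasDifferentExponent.tower h₁ h₂ (hπ.toCompletion (isNonarchimedean_restrict L hw))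
    (hϖ.toCompletion hw) (e := e) (by rw [norm_toCompletion, norm_toCompletion]; exact he)
  -- Restricting to K in two stages or at once gives equal absolute values, but not definitionally;
  -- their completions are identified by an isomorphism.
  obtain ⟨σ, c, hc, hσc, hσ, hσn⟩ := exists_completion_ringEquiv
    (w := restrict K (restrict L w)) (w' := restrict K w) (by
      rw [restrict_restrict]; exact .rfl)
  let := completionNormedAlgebra K w
  refine key.of_ringEquiv σ (.refl _) (fun x => ?_) zero_lt_one hc hσn (by simp)
  refine (denseRange_toCompletion _).induction_on x ?_ fun a => ?_
  · exact isClosed_eq ((continuous_algebraMap_completion K w).comp hσc)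
      ((continuous_algebraMap_completion L w).comp
        (continuous_algebraMap_completion K (restrict L w)))
  · rw [hσ, algebraMap_toCompletion]
    change _ = algebraMap (restrict L w).Completion w.Completion
      (algebraMap (restrict K (restrict L w)).Completion (restrict L w).Completion _)
    rw [algebraMap_toCompletion, algebraMap_toCompletion, ← IsScalarTower.algebraMap_apply]

/-- The different exponent vanishes if `L = K(α)`, the minimal polynomial `f` of `α` is integral and
`f'(α)` is a unit. -/
theorem HasDifferentExponentAt.eq_zero [FiniteDimensional K L] [Algebra.IsSeparable K L]
    {w : AbsoluteValue L ℝ} (hw : IsNonarchimedean w) (hK : (restrict K w).IsNontrivial) {d : ℕ}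
    (h : HasDifferentExponentAt K w d) {α : L} (hα : Algebra.adjoin K {α} = ⊤)
    (hcoeff : ∀ i, restrict K w ((minpoly K α).coeff i) ≤ 1)
    (hderiv : w (aeval α (derivative (minpoly K α))) = 1) : d = 0 := by
  have := isUltrametricDist_completion hw
  have := isUltrametricDist_completion (isNonarchimedean_restrict K hw)
  let := completionNormedAlgebra K w
  let := completionNontriviallyNormedField hK
  have := finiteDimensional_completion hK
  have := isSeparable_completion hK
  set a := toCompletion w α
  set f := (minpoly K α).map (toCompletion (restrict K w))
  set g := minpoly (restrict K w).Completion a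
  have hmon : (minpoly K α).Monic := minpoly.monic (Algebra.IsIntegral.isIntegral α)
  have hgmon : g.Monic := minpoly.monic (Algebra.IsIntegral.isIntegral a)
  have hf0 : aeval a f = 0 := by rw [aeval_toCompletion, minpoly.aeval, map_zero]
  have hfc : ∀ i, ‖f.coeff i‖ ≤ 1 := fun i => by
    rw [coeff_map, norm_toCompletion]; exact hcoeff i
  have ha : ‖a‖ ≤ 1 := by
    refine norm_le_one_of_eval_eq_zero ((hmon.map _).map (algebraMap _ w.Completion)) (fun i => ?_)
      ((eval_map_algebraMap f a).trans hf0)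
    rw [coeff_map, norm_algebraMap']
    exact hfc i
  have hgc : ∀ i, ‖g.coeff i‖ ≤ 1 := norm_coeff_minpoly_le_one ha
  obtain ⟨q, hq⟩ : g ∣ f := minpoly.dvd _ _ hf0
  have hqa : ‖aeval a q‖ ≤ 1 := by
    rw [← eval_map_algebraMap]
    refine norm_eval_le_one (fun i => ?_) ha
    rw [coeff_map, norm_algebraMap']
    exact norm_coeff_le_one_of_mul hgmon hfc hgc hq i
  have hga : ‖aeval a (derivative g)‖ ≤ 1 := by
    rw [← eval_map_algebraMap]
    refine norm_eval_le_one (fun i => ?_) ha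
    rw [coeff_map, norm_algebraMap', coeff_derivative, norm_mul]
    refine mul_le_one₀ (hgc _) (norm_nonneg _) ?_
    exact_mod_cast IsUltrametricDist.norm_natCast_le_one (restrict K w).Completion (i + 1)
  -- The minimal polynomial g over the completion may be a proper factor of f. Since f'(a) = g'(a)
  -- q(a) with both factors integral and the product a unit, g'(a) is a unit.
  have hprod : aeval a (derivative f) = aeval a (derivative g) * aeval a q := by
    rw [hq, derivative_mul, map_add, map_mul, map_mul, minpoly.aeval, zero_mul, add_zero]
  have hfa : ‖aeval a (derivative f)‖ = 1 := by
    rw [derivative_map, aeval_toCompletion, norm_toCompletion, hderiv]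
  refine HasDifferentExponent.eq_zero h ha (adjoin_toCompletion_eq_top hK hα)
    (le_antisymm hga ?_)
  rw [hprod, norm_mul] at hfa
  rw [← hfa]
  exact mul_le_of_le_one_right (norm_nonneg _) hqa

end Tower

end DiscreteAbsoluteValue

/-! ### Absolute values centered at primes of Dedekind domains -/

section Center

open IsDedekindDomain WithZero

variable {R : Type*} {K : Type*} [CommRing R] [Field K] [Algebra R K]

/-- `w` is nonarchimedean, at most `1` on `R`, and less than `1` exactly on the prime `v`. -/
structure IsCenter (v : HeightOneSpectrum R) (w : AbsoluteValue K ℝ) : Prop where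
  isNonarchimedean : IsNonarchimedean w
  le_one : ∀ r : R, w (algebraMap R K r) ≤ 1
  mem_iff : ∀ r : R, r ∈ v.asIdeal ↔ w (algebraMap R K r) < 1

theorem isNonarchimedean_of_isEquiv {w w' : AbsoluteValue K ℝ} (h : IsNonarchimedean w)
    (hw : w.IsEquiv w') : IsNonarchimedean w' := fun x y => by
  rcases le_max_iff.mp (h x y) with h | h
  · exact le_max_of_le_left ((hw _ _).mp h)
  · exact le_max_of_le_right ((hw _ _).mp h)

theorem IsCenter.of_isEquiv {v : HeightOneSpectrum R} {w w' : AbsoluteValue K ℝ}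
    (h : IsCenter v w) (hw : w.IsEquiv w') : IsCenter v w' :=
  ⟨isNonarchimedean_of_isEquiv h.isNonarchimedean hw, fun r => hw.le_one_iff.mp (h.le_one r),
    fun r => (h.mem_iff r).trans hw.lt_one_iff⟩

theorem IsCenter.unique {v v' : HeightOneSpectrum R} {w : AbsoluteValue K ℝ} (h : IsCenter v w)
    (h' : IsCenter v' w) : v = v' :=
  HeightOneSpectrum.ext (Ideal.ext fun r => (h.mem_iff r).trans (h'.mem_iff r).symm)

variable [IsDedekindDomain R] [IsFractionRing R K]

/-- The base 2 is arbitrary, as another base greater than 1 only changes the absolute value within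
its class. -/
theorem isCenter_adicAbv (v : HeightOneSpectrum R) :
    IsCenter v (v.adicAbv (K := K) one_lt_two) :=
  ⟨v.isNonarchimedean_adicAbv _, v.adicAbv_coe_le_one _,
    fun r => (v.adicAbv_coe_lt_one_iff _ r).symm⟩

/-- The elements of R with w < 1 form a prime ideal. It is nonzero, since otherwise w would be 1 on
all nonzero elements of R and thus trivial on the fraction field. -/
theorem exists_isCenter {w : AbsoluteValue K ℝ} (hw : IsNonarchimedean w) (hnt : w.IsNontrivial)
    (hR : ∀ r : R, w (algebraMap R K r) ≤ 1) : ∃ v : HeightOneSpectrum R, IsCenter v w := by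
  let I : Ideal R :=
    { carrier := {r | w (algebraMap R K r) < 1}
      add_mem' := fun {a b} ha hb => by
        rw [Set.mem_ofPred_eq, map_add]
        exact (hw _ _).trans_lt (max_lt ha hb)
      zero_mem' := by simp
      smul_mem' := fun c x hx => by
        rw [Set.mem_ofPred_eq, smul_eq_mul, map_mul, map_mul]
        exact (mul_le_of_le_one_left (w.nonneg _) (hR c)).trans_lt hx }
  have hmem : ∀ r, r ∈ I ↔ w (algebraMap R K r) < 1 := fun r => Iff.rfl
  have hprime : I.IsPrime := by
    refine ⟨fun h => ?_, fun {x y} hxy => ?_⟩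
    · have := (hmem 1).mp (h ▸ Submodule.mem_top)
      simp at this
    · by_contra hcon
      rw [not_or, hmem, hmem, not_lt, not_lt] at hcon
      rw [hmem, map_mul, map_mul, le_antisymm (hR x) hcon.1, le_antisymm (hR y) hcon.2] at hxy
      simp at hxy
  refine ⟨⟨I, hprime, fun hbot => ?_⟩, hw, hR, hmem⟩
  have hone : ∀ r : R, r ≠ 0 → w (algebraMap R K r) = 1 := fun r hr => by
    refine le_antisymm (hR r) (not_lt.mp fun h => hr ?_)
    have : r ∈ I := h
    rwa [hbot] at this
  obtain ⟨x, hx0, hx⟩ := hnt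
  obtain ⟨a, b, hb, rfl⟩ := IsFractionRing.div_surjective (A := R) x
  have ha : a ≠ 0 := by rintro rfl; simp at hx0
  rw [map_div₀, hone a ha, hone b (nonZeroDivisors.ne_zero hb), div_one] at hx
  exact hx rfl

theorem IsCenter.exists_mul_eq {v : HeightOneSpectrum R} {w : AbsoluteValue K ℝ}
    (h : IsCenter v w) {x : K} (hx : v.valuation K x ≤ 1) :
    ∃ n d : R, w (algebraMap R K d) = 1 ∧ d ∉ v.asIdeal ∧
      x * algebraMap R K d = algebraMap R K n := by
  obtain ⟨n, d, hnd⟩ := v.exists_primeCompl_mul_eq_of_integer x hx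
  have hd : (d : R) ∉ v.asIdeal := d.2
  exact ⟨n, d, le_antisymm (h.le_one _) (not_lt.mp fun hlt => hd ((h.mem_iff _).mpr hlt)), hd, hnd⟩

theorem IsCenter.lt_one {v : HeightOneSpectrum R} {w : AbsoluteValue K ℝ}
    (h : IsCenter v w) {x : K} (hx : v.valuation K x < 1) : w x < 1 := by
  obtain ⟨n, d, hd, hdv, hnd⟩ := h.exists_mul_eq hx.le
  have hn : n ∈ v.asIdeal := by
    rw [← v.valuation_lt_one_iff_mem (K := K)]
    change v.valuation K (algebraMap R K n) < 1
    rw [← hnd, map_mul,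
      (v.valuation_eq_one_iff_notMem (K := K)).mpr hdv, mul_one]
    exact hx
  have := (h.mem_iff n).mp hn
  rwa [← hnd, map_mul, hd, mul_one] at this

theorem adicAbv_lt_one_iff (v : HeightOneSpectrum R) (x : K) :
    v.adicAbv (K := K) one_lt_two x < 1 ↔ v.valuation K x < 1 := by
  simp only [HeightOneSpectrum.adicAbv, AbsoluteValue.coe_mk, MulHom.coe_mk,
    HeightOneSpectrum.adicAbvDef]
  rw [NNReal.coe_lt_one, WithZeroMulInt.toNNReal_lt_one_iff one_lt_two]

theorem ne_zero_of_valuation_eq_exp {v : HeightOneSpectrum R} {π : K} {n : ℤ}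
    (hπ : v.valuation K π = exp n) : π ≠ 0 := by
  rintro rfl
  rw [map_zero] at hπ
  exact exp_ne_zero hπ.symm

theorem adicAbv_isNontrivial (v : HeightOneSpectrum R) :
    (v.adicAbv (K := K) one_lt_two).IsNontrivial := by
  obtain ⟨π, hπ⟩ := v.valuation_exists_uniformizer K
  refine ⟨π, ne_zero_of_valuation_eq_exp hπ, ((adicAbv_lt_one_iff v π).mpr ?_).ne⟩
  rw [hπ, ← exp_zero, exp_lt_exp]; norm_num

/-- For a nontrivial absolute value, one implication between the conditions "less than 1" already
forces equivalence. -/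
theorem IsCenter.isEquiv_adicAbv {v : HeightOneSpectrum R} {w : AbsoluteValue K ℝ}
    (h : IsCenter v w) : (v.adicAbv (K := K) one_lt_two).IsEquiv w :=
  AbsoluteValue.isEquiv_of_lt_one_imp (adicAbv_isNontrivial v) fun x hx =>
    h.lt_one ((adicAbv_lt_one_iff v x).mp hx)

theorem IsCenter.isEquiv {v : HeightOneSpectrum R} {w w' : AbsoluteValue K ℝ}
    (h : IsCenter v w) (h' : IsCenter v w') : w.IsEquiv w' :=
  h.isEquiv_adicAbv.symm.trans h'.isEquiv_adicAbv

theorem IsCenter.lt_one_iff {v : HeightOneSpectrum R} {w : AbsoluteValue K ℝ}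
    (h : IsCenter v w) (x : K) : w x < 1 ↔ v.valuation K x < 1 :=
  (h.isEquiv_adicAbv.lt_one_iff).symm.trans (adicAbv_lt_one_iff v x)

theorem IsCenter.le_one_iff {v : HeightOneSpectrum R} {w : AbsoluteValue K ℝ}
    (h : IsCenter v w) (x : K) : w x ≤ 1 ↔ v.valuation K x ≤ 1 := by
  rcases eq_or_ne x 0 with rfl | hx
  · simp
  have := (h.lt_one_iff x⁻¹).not
  rwa [map_inv₀, map_inv₀, not_lt, not_lt, one_le_inv₀ (w.pos hx),
    one_le_inv₀ (zero_lt_iff.mpr ((map_ne_zero _).mpr hx))] at this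

theorem IsCenter.eq_one {v : HeightOneSpectrum R} {w : AbsoluteValue K ℝ}
    (h : IsCenter v w) {x : K} (hx : v.valuation K x = 1) : w x = 1 :=
  le_antisymm ((h.le_one_iff x).mpr hx.le) (not_lt.mp fun hlt => by
    have := (h.lt_one_iff x).mp hlt
    rw [hx] at this
    exact lt_irrefl _ this)

theorem IsCenter.eq_zpow {v : HeightOneSpectrum R} {w : AbsoluteValue K ℝ}
    (h : IsCenter v w) {π x : K} (hπ : v.valuation K π = exp (-1 : ℤ)) {n : ℤ}
    (hx : v.valuation K x = exp (-n)) : w x = w π ^ n := by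
  have hπ0 : π ≠ 0 := ne_zero_of_valuation_eq_exp hπ
  have h1 : v.valuation K (x / π ^ n) = 1 := by
    rw [map_div₀, map_zpow₀, hx, hπ, ← exp_zsmul]
    simp
  have h2 := h.eq_one h1
  rw [map_div₀, map_zpow₀] at h2
  exact (div_eq_one_iff_eq (zpow_ne_zero _ (w.ne_zero hπ0))).mp h2

theorem IsCenter.isUniformizerAt {v : HeightOneSpectrum R} {w : AbsoluteValue K ℝ}
    (h : IsCenter v w) {π : K} (hπ : v.valuation K π = exp (-1 : ℤ)) : IsUniformizerAt w π := by
  refine ⟨ne_zero_of_valuation_eq_exp hπ, (h.lt_one_iff π).mpr ?_, fun x hx => ?_⟩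
  · rw [hπ, ← exp_zero, exp_lt_exp]; norm_num
  · refine ⟨-log (v.valuation K x), h.eq_zpow hπ ?_⟩
    rw [neg_neg, exp_log ((map_ne_zero _).mpr hx)]

theorem residue_eq_zero_iff {E : Type*} [NormedField E] [IsUltrametricDist E]
    (x : valuationRing E) : IsLocalRing.residue (valuationRing E) x = 0 ↔ ‖(x : E)‖ < 1 := by
  rw [IsLocalRing.residue_eq_zero_iff, IsLocalRing.mem_maximalIdeal, mem_nonunits_iff]
  constructor
  · intro hx
    refine lt_of_le_of_ne x.2 fun h => hx ?_
    have h0 : (x : E) ≠ 0 := norm_ne_zero_iff.mp (by rw [h]; exact one_ne_zero)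
    refine IsUnit.of_mul_eq_one
      (⟨(x : E)⁻¹, mem_valuationRing.mpr (by rw [norm_inv, h, inv_one])⟩) ?_
    exact Subtype.ext (mul_inv_cancel₀ h0)
  · rintro hx hu
    obtain ⟨y, hy⟩ := hu.exists_right_inv
    have h1 : (x : E) * y = 1 := congrArg Subtype.val hy
    have h3 : ‖(x : E)‖ * ‖(y : E)‖ = 1 := by rw [← norm_mul, h1, norm_one]
    have h5 : ‖(y : E)‖ ≤ 1 := y.2
    nlinarith [norm_nonneg (x : E), norm_nonneg (y : E)]

/-- The cardinality of the residue field of `w` can be computed on any subring surjecting onto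
it. -/
theorem natCard_residueField {S : Type*} [CommRing S] [Algebra S K] {w : AbsoluteValue K ℝ}
    (hw : IsNonarchimedean w) (hS : ∀ r : S, w (algebraMap S K r) ≤ 1) (I : Ideal S)
    (hI : ∀ r, r ∈ I ↔ w (algebraMap S K r) < 1)
    (happrox : ∀ x, w x ≤ 1 → ∃ r : S, w (x - algebraMap S K r) < 1) :
    haveI := isUltrametricDist_withAbs hw
    Nat.card (IsLocalRing.ResidueField (valuationRing (WithAbs w))) = Nat.card (S ⧸ I) := by
  have := isUltrametricDist_withAbs hw
  let ι : S →+* valuationRing (WithAbs w) :=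
    ((WithAbs.equiv w).symm.toRingHom.comp (algebraMap S K)).codRestrict _ fun r =>
      mem_valuationRing.mpr (hS r)
  let φ := (IsLocalRing.residue (valuationRing (WithAbs w))).comp ι
  have hker : RingHom.ker φ = I := by
    ext r
    rw [RingHom.mem_ker, hI]
    exact residue_eq_zero_iff _
  have hsurj : Function.Surjective φ := by
    intro y
    obtain ⟨x, rfl⟩ := IsLocalRing.residue_surjective y
    obtain ⟨r, hr⟩ := happrox (WithAbs.ofAbs (x : WithAbs w)) x.2
    refine ⟨r, ?_⟩
    change IsLocalRing.residue _ (ι r) = _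
    rw [eq_comm, ← sub_eq_zero, ← map_sub]
    exact (residue_eq_zero_iff _).mpr hr
  rw [← hker]
  exact (Nat.card_congr (RingHom.quotientKerEquivOfSurjective hsurj).toEquiv).symm

theorem IsCenter.exists_sub_lt_one {v : HeightOneSpectrum R} {w : AbsoluteValue K ℝ}
    (h : IsCenter v w) {x : K} (hx : w x ≤ 1) : ∃ r : R, w (x - algebraMap R K r) < 1 := by
  obtain ⟨r, hr⟩ := v.exists_valuation_sub_lt_of_integer ((h.le_one_iff x).mp hx) 1
  refine ⟨r, ?_⟩
  rw [w.map_sub, h.lt_one_iff]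
  exact hr

theorem not_isArchimedean_of_rep {P : Place K} (h : IsNonarchimedean P.rep) :
    ¬ P.IsArchimedean := by
  rintro ⟨w, hw, hP, x, y, hxy⟩
  have h1 : w.IsEquiv P.rep := Quotient.exact (hP.trans P.mk_rep.symm)
  exact absurd (isNonarchimedean_of_isEquiv h h1.symm x y) (not_le.mpr hxy)

theorem isArchimedean_iff_rep {P : Place K} : P.IsArchimedean ↔ ¬ IsNonarchimedean P.rep :=
  ⟨fun h h' => not_isArchimedean_of_rep h' h, fun h => by
    by_contra hP; exact h (P.isNonarchimedean_rep hP)⟩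

theorem IsCenter.norm_eq {v : HeightOneSpectrum R} {P : Place K} (h : IsCenter v P.rep) :
    P.norm = Nat.card (R ⧸ v.asIdeal) := by
  rw [Place.norm, dif_neg (not_isArchimedean_of_rep h.isNonarchimedean)]
  exact congrArg Nat.cast (natCard_residueField h.isNonarchimedean h.le_one _ h.mem_iff
    fun x hx => h.exists_sub_lt_one hx)

end Center

/-! ### The fundamental identity -/

section FundamentalIdentity

open IsDedekindDomain WithZero

variable {K : Type u} {L : Type v} [Field K] [Field L] [Algebra K L]

theorem range_unitsMap_eq_zpowers {w : AbsoluteValue K ℝ} {π : K} (hπ : IsUniformizerAt w π) :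
    (Units.map (w : K →* ℝ)).range = Subgroup.zpowers (Units.mk0 (w π) hπ.pos.ne') := by
  ext u
  rw [MonoidHom.mem_range, Subgroup.mem_zpowers_iff]
  constructor
  · rintro ⟨x, rfl⟩
    obtain ⟨n, hn⟩ := hπ.exists_zpow x x.ne_zero
    exact ⟨n, Units.ext (by simpa using hn.symm)⟩
  · rintro ⟨n, rfl⟩
    exact ⟨Units.mk0 π hπ.ne_zero ^ n, Units.ext (by simp)⟩

/-- The powers of u form a copy of ℤ, in which the powers of u ^ e correspond to eℤ. -/
theorem relIndex_zpowers_pow {G : Type*} [Group G] {u : G} (hu : ∀ n : ℤ, u ^ n = 1 → n = 0)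
    (e : ℕ) : (Subgroup.zpowers (u ^ e)).relIndex (Subgroup.zpowers u) = e := by
  have hinj : Function.Injective (zpowersHom G u) := by
    rw [injective_iff_map_eq_one]
    intro n hn
    exact hu _ hn
  have h1 : Subgroup.zpowers u = (⊤ : Subgroup (Multiplicative ℤ)).map (zpowersHom G u) := by
    ext x
    simp [Subgroup.mem_zpowers_iff, Multiplicative.exists]
  have h2 : Subgroup.zpowers (u ^ e) =
      (AddSubgroup.toSubgroup (AddSubgroup.zmultiples (e : ℤ))).map (zpowersHom G u) := by
    ext x
    rw [Subgroup.mem_zpowers_iff, Subgroup.mem_map]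
    constructor
    · rintro ⟨n, rfl⟩
      refine ⟨Multiplicative.ofAdd ((e : ℤ) * n), ⟨n, by simp [mul_comm]⟩, ?_⟩
      simp only [zpowersHom_apply, toAdd_ofAdd, ← zpow_natCast, ← zpow_mul, mul_comm]
    · rintro ⟨m, ⟨n, hn⟩, rfl⟩
      refine ⟨n, ?_⟩
      have : m = Multiplicative.ofAdd ((e : ℤ) * n) := by
        rw [← ofAdd_toAdd m, mul_comm]; congr 1; rw [← smul_eq_mul]; exact hn.symm
      rw [this]
      simp only [zpowersHom_apply, toAdd_ofAdd, ← zpow_natCast, ← zpow_mul, mul_comm]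
  rw [h1, h2, Subgroup.relIndex_map_map_of_injective _ _ hinj, Subgroup.relIndex_top_right,
    AddSubgroup.index_toSubgroup, Int.index_zmultiples, Int.natAbs_natCast]

theorem ramificationIndex_eq {Q : Place L} (hQ : ¬ Q.IsArchimedean) {π : K} {ϖ : L}
    (hπ : IsUniformizerAt (restrict K Q.rep) π) (hϖ : IsUniformizerAt Q.rep ϖ) {e : ℕ}
    (he : Q.rep (algebraMap K L π) = Q.rep ϖ ^ e) : Q.ramificationIndex K = e := by
  rw [Place.ramificationIndex, if_neg hQ, range_unitsMap_eq_zpowers hπ,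
    range_unitsMap_eq_zpowers hϖ]
  have h : Units.mk0 (restrict K Q.rep π) hπ.pos.ne' = Units.mk0 (Q.rep ϖ) hϖ.pos.ne' ^ e :=
    Units.ext he
  rw [h]
  refine relIndex_zpowers_pow (fun n hn => ?_) e
  have h1 : Q.rep ϖ ^ n = 1 := by simpa using congrArg Units.val hn
  exact (zpow_eq_one_iff_right₀ hϖ.pos.le hϖ.lt_one.ne).mp h1

theorem exists_pow_eq {w : AbsoluteValue L ℝ} {π : K} {ϖ : L}
    (hπ : IsUniformizerAt (restrict K w) π) (hϖ : IsUniformizerAt w ϖ) :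
    ∃ e : ℕ, w (algebraMap K L π) = w ϖ ^ e := by
  obtain ⟨n, hn⟩ := hϖ.exists_zpow (algebraMap K L π) ((map_ne_zero _).mpr hπ.ne_zero)
  have h1 : w (algebraMap K L π) < 1 := hπ.lt_one
  have h2 : 0 ≤ n := by
    by_contra hneg
    rw [hn] at h1
    exact absurd h1 (not_lt.mpr (one_le_zpow_of_nonpos₀ hϖ.pos hϖ.lt_one.le (by omega)))
  obtain ⟨e, rfl⟩ := Int.eq_ofNat_of_zero_le h2
  exact ⟨e, by rw [hn, zpow_natCast]⟩

theorem isNonarchimedean_of_natCast_le_one {w : AbsoluteValue K ℝ} (h : ∀ n : ℕ, w n ≤ 1) :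
    IsNonarchimedean w := by
  have : IsUltrametricDist (WithAbs w) :=
    IsUltrametricDist.isUltrametricDist_of_forall_norm_natCast_le_one fun n => by
      have := h n
      rwa [← map_natCast (WithAbs.equiv w) n] at this
  intro x y
  exact IsUltrametricDist.norm_add_le_max (WithAbs.toAbs w x) (WithAbs.toAbs w y)

/-- The ultrametric inequality is detected on the natural numbers, which lie in K. -/
theorem isNonarchimedean_iff_restrict {w : AbsoluteValue L ℝ} :
    IsNonarchimedean w ↔ IsNonarchimedean (restrict K w) := by
  refine ⟨isNonarchimedean_restrict K, fun h => isNonarchimedean_of_natCast_le_one fun n => ?_⟩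
  have := h.apply_natCast_le_one (n := n)
  change w (algebraMap K L n) ≤ 1 at this
  rwa [map_natCast] at this

theorem le_one_of_isIntegral {A : Type*} [CommRing A] [Algebra A L] {w : AbsoluteValue L ℝ}
    (hw : IsNonarchimedean w) (hA : ∀ a : A, w (algebraMap A L a) ≤ 1) {x : L}
    (hx : IsIntegral A x) : w x ≤ 1 := by
  have := isUltrametricDist_withAbs hw
  obtain ⟨p, hp, hpx⟩ := hx
  refine norm_le_one_of_eval_eq_zero (F := WithAbs w) (x := WithAbs.toAbs w x)
    (hp.map ((WithAbs.equiv w).symm.toRingHom.comp (algebraMap A L))) (fun i => ?_) ?_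
  · rw [Polynomial.coeff_map]
    exact hA _
  · rw [Polynomial.eval_map]
    have := congrArg (WithAbs.equiv w).symm.toRingHom hpx
    rwa [Polynomial.hom_eval₂, map_zero] at this

/-- If w were trivial on K, every element of L, being integral over K, would satisfy w ≤ 1; applied
to inverses, this makes w trivial. -/
theorem restrict_isNontrivial [Algebra.IsAlgebraic K L] {w : AbsoluteValue L ℝ}
    (hw : w.IsNontrivial) : (restrict K w).IsNontrivial := by
  by_contra h
  have hK : ∀ x : K, w (algebraMap K L x) ≤ 1 := fun x => by
    rcases eq_or_ne x 0 with rfl | hx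
    · simp
    · by_contra hne
      exact h ⟨x, hx, fun heq => hne (le_of_eq heq)⟩
  have hna : IsNonarchimedean w := isNonarchimedean_of_natCast_le_one fun n => by
    simpa using hK n
  have hle : ∀ x : L, w x ≤ 1 := fun x =>
    le_one_of_isIntegral hna hK (Algebra.IsAlgebraic.isAlgebraic (R := K) x).isIntegral
  obtain ⟨x, hx0, hx⟩ := hw
  refine hx (le_antisymm (hle x) ?_)
  have := hle x⁻¹
  rwa [map_inv₀, inv_le_one₀ (w.pos hx0)] at this

theorem isEquiv_rep_mk {w : AbsoluteValue K ℝ} (hw : w.IsNontrivial) :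
    (Place.mk w hw).rep.IsEquiv w :=
  Quotient.exact (Place.mk w hw).mk_rep

theorem mk_eq_mk_iff {w w' : AbsoluteValue K ℝ} {hw : w.IsNontrivial} {hw' : w'.IsNontrivial} :
    Place.mk w hw = Place.mk w' hw' ↔ w.IsEquiv w' := Quotient.eq (r := placeSetoid K)

theorem liesOver_iff [Algebra.IsAlgebraic K L] {Q : Place L} {P : Place K} :
    Q.LiesOver P ↔ (restrict K Q.rep).IsEquiv P.rep := by
  have hnt := restrict_isNontrivial (K := K) Q.rep_isNontrivial
  constructor
  · rintro ⟨h, rfl⟩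
    exact (isEquiv_rep_mk h).symm
  · intro h
    refine ⟨hnt, ?_⟩
    rw [← P.mk_rep]
    exact mk_eq_mk_iff.mpr h

variable {A B : Type*} [CommRing A] [CommRing B] [Algebra A B] [Algebra A K] [Algebra A L]
  [IsScalarTower A K L] [Algebra B L] [IsScalarTower A B L]

theorem IsCenter.liesOver {v : HeightOneSpectrum A} {V : HeightOneSpectrum B}
    {w : AbsoluteValue L ℝ} (hv : IsCenter v (restrict K w)) (hV : IsCenter V w) :
    V.asIdeal.LiesOver v.asIdeal := by
  refine ⟨Ideal.ext fun r => ?_⟩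
  rw [Ideal.mem_comap, hv.mem_iff, hV.mem_iff, ← IsScalarTower.algebraMap_apply,
    IsScalarTower.algebraMap_apply A K L]
  rfl

theorem IsCenter.restrict_of_liesOver {v : HeightOneSpectrum A} {V : HeightOneSpectrum B}
    [h : V.asIdeal.LiesOver v.asIdeal] {w : AbsoluteValue L ℝ} (hV : IsCenter V w) :
    IsCenter v (restrict K w) := by
  have key : ∀ r : A, restrict K w (algebraMap A K r) = w (algebraMap B L (algebraMap A B r)) :=
    fun r => by
      rw [← IsScalarTower.algebraMap_apply, IsScalarTower.algebraMap_apply A K L]; rfl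
  refine ⟨isNonarchimedean_restrict K hV.isNonarchimedean, fun r => ?_, fun r => ?_⟩
  · rw [key]; exact hV.le_one _
  · rw [key, ← hV.mem_iff, h.over, Ideal.mem_comap]

variable [IsDedekindDomain B] [IsFractionRing B L]

theorem IsCenter.exists_isCenter_of_restrict [Algebra.IsIntegral A B] {v : HeightOneSpectrum A}
    {w : AbsoluteValue L ℝ} (hv : IsCenter v (restrict K w)) (hw : w.IsNontrivial) :
    ∃ V : HeightOneSpectrum B, IsCenter V w := by
  have hna : IsNonarchimedean w := isNonarchimedean_iff_restrict.mpr hv.isNonarchimedean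
  refine exists_isCenter hna hw fun b => le_one_of_isIntegral (A := A) hna (fun a => ?_)
    ((Algebra.IsIntegral.isIntegral b).algebraMap)
  rw [IsScalarTower.algebraMap_apply A K L]
  exact hv.le_one a

variable [IsDedekindDomain A]

theorem natCard_quotient_eq_pow [Module.Finite A B] (v : HeightOneSpectrum A)
    (V : HeightOneSpectrum B) [V.asIdeal.LiesOver v.asIdeal] :
    Nat.card (B ⧸ V.asIdeal) = Nat.card (A ⧸ v.asIdeal) ^ V.asIdeal.inertiaDeg A := by
  have := v.isMaximal
  have := V.isMaximal
  let := Ideal.Quotient.field v.asIdeal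
  rw [Ideal.inertiaDeg_eq_of_isMaximal v.asIdeal V.asIdeal]
  exact Module.natCard_eq_pow_finrank

variable [IsFractionRing A K]

theorem IsCenter.ramificationIndex_eq [Module.IsTorsionFree A B] {v : HeightOneSpectrum A}
    {V : HeightOneSpectrum B}
    {Q : Place L} (hv : IsCenter v (restrict K Q.rep)) (hV : IsCenter V Q.rep) :
    Q.ramificationIndex K = V.asIdeal.ramificationIdx A := by
  have := hv.liesOver hV
  obtain ⟨π, hπ⟩ := v.valuation_exists_uniformizer K
  obtain ⟨ϖ, hϖ⟩ := V.valuation_exists_uniformizer L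
  refine GlobalField.ramificationIndex_eq (not_isArchimedean_of_rep hV.isNonarchimedean)
    (hv.isUniformizerAt hπ) (hV.isUniformizerAt hϖ) ?_
  rw [← zpow_natCast]
  refine hV.eq_zpow hϖ ?_
  rw [← HeightOneSpectrum.valuation_liesOver L v V, hπ,
    Ideal.ramificationIdx'_eq_ramificationIdx _ _ v.ne_bot, ← exp_nsmul]
  simp

variable (L B) in
/-- The fundamental identity `∑ e f = [L : K]` for the places of `L` over a place of `K`. -/
theorem exists_fundamental_identity [Algebra.IsAlgebraic K L] [Module.Finite A B]
    [Module.IsTorsionFree A B] {P : Place K}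
    {v : HeightOneSpectrum A} (hv : IsCenter v P.rep) :
    ∃ s : Finset (Place L), (∀ Q, Q ∈ s ↔ Q.LiesOver P) ∧
      (∀ Q ∈ s, ∃ V : HeightOneSpectrum B, IsCenter V Q.rep) ∧
      ∃ f : Place L → ℕ, (∀ Q ∈ s, Q.norm = P.norm ^ f Q) ∧
        ∑ Q ∈ s, Q.ramificationIndex K * f Q = Module.finrank K L := by
  classical
  have := v.isMaximal
  have hfin := IsDedekindDomain.primesOver_finite v.asIdeal B
  let : Fintype (v.asIdeal.primesOver B) := hfin.fintype
  let V : v.asIdeal.primesOver B → HeightOneSpectrum B := fun q =>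
    ⟨q.1, q.2.1, by
      have := q.2.2
      exact Ideal.ne_bot_of_liesOver_of_ne_bot v.ne_bot q.1⟩
  have hVinj : Function.Injective V := fun q q' h => Subtype.ext (congrArg (·.asIdeal) h)
  have hVl : ∀ q, (V q).asIdeal.LiesOver v.asIdeal := fun q => q.2.2
  let pl : v.asIdeal.primesOver B → Place L := fun q =>
    Place.mk _ (adicAbv_isNontrivial (K := L) (V q))
  have hpl : ∀ q, IsCenter (V q) (pl q).rep := fun q =>
    (isCenter_adicAbv (V q)).of_isEquiv (isEquiv_rep_mk _).symm
  have hinj : Function.Injective pl := fun q q' h =>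
    hVinj ((hpl q).unique (h ▸ hpl q'))
  have hvq : ∀ q, IsCenter v (restrict K (pl q).rep) := fun q =>
    have := hVl q
    (hpl q).restrict_of_liesOver
  -- The places over P are the classes of the adic absolute values at the primes of B over v. The
  -- inertia degrees are extended by 0 to all other places.
  refine ⟨Finset.univ.image pl, fun Q => ?_, fun Q hQ => ?_,
    Function.extend pl (fun q => q.1.inertiaDeg A) 0, fun Q hQ => ?_, ?_⟩
  · rw [Finset.mem_image, liesOver_iff]
    constructor
    · rintro ⟨q, -, rfl⟩
      exact (hvq q).isEquiv hv
    · intro h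
      have hvQ := hv.of_isEquiv h.symm
      obtain ⟨W, hW⟩ := hvQ.exists_isCenter_of_restrict (B := B) Q.rep_isNontrivial
      have hWl := hvQ.liesOver hW
      let q : v.asIdeal.primesOver B := ⟨W.asIdeal, W.isPrime, hWl⟩
      refine ⟨q, Finset.mem_univ _, ?_⟩
      rw [← Q.mk_rep]
      exact mk_eq_mk_iff.mpr (IsCenter.isEquiv (isCenter_adicAbv (V q)) hW)
  · obtain ⟨q, -, rfl⟩ := Finset.mem_image.mp hQ
    exact ⟨V q, hpl q⟩
  · obtain ⟨q, -, rfl⟩ := Finset.mem_image.mp hQ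
    have := hVl q
    rw [hinj.extend_apply, (hpl q).norm_eq, hv.norm_eq, natCard_quotient_eq_pow v (V q),
      Nat.cast_pow]
  · rw [Finset.sum_image fun q _ q' _ h => hinj h]
    rw [IsFractionRing.finrank_eq A K B L, ← Ideal.sum_ramification_inertia_eq_finrank v.asIdeal B]
    refine Finset.sum_congr rfl fun q _ => ?_
    rw [hinj.extend_apply, (hvq q).ramificationIndex_eq (hpl q)]

end FundamentalIdentity

/-! ### Discrete places -/

section DiscretePlaces

open IsDedekindDomain

variable {K : Type u} {L : Type v} [Field K] [Field L] [Algebra K L]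

/-- The valuation ring `{x | w x ≤ 1}` in `K`. -/
def absValuationSubring {w : AbsoluteValue K ℝ} (hw : IsNonarchimedean w) : ValuationSubring K where
  carrier := {x | w x ≤ 1}
  mul_mem' := fun {a b} ha hb => by
    rw [Set.mem_ofPred_eq, map_mul]
    exact mul_le_one₀ ha (w.nonneg b) hb
  one_mem' := by simp
  add_mem' := fun {a b} ha hb => (hw a b).trans (max_le ha hb)
  zero_mem' := by simp
  neg_mem' := fun {a} ha => by rwa [Set.mem_ofPred_eq, w.map_neg]
  mem_or_inv_mem' := fun x => by
    rcases eq_or_ne x 0 with rfl | hx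
    · left; simp
    rw [Set.mem_ofPred_eq, Set.mem_ofPred_eq, map_inv₀, inv_le_one₀ (w.pos hx)]
    exact le_total _ _

theorem isUnit_absValuationSubring {w : AbsoluteValue K ℝ} (hw : IsNonarchimedean w)
    {x : absValuationSubring hw} (hx : w x = 1) : IsUnit x := by
  refine IsUnit.of_mul_eq_one ⟨(x : K)⁻¹, ?_⟩ (Subtype.ext (mul_inv_cancel₀ ?_))
  · change w (x : K)⁻¹ ≤ 1
    rw [map_inv₀, hx, inv_one]
  · intro h
    rw [h, map_zero] at hx
    exact zero_ne_one hx

/-- Every nonzero element is a unit times a power of π, because its value is a nonnegative power of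
w π. -/
theorem isDiscreteValuationRing_absValuationSubring {w : AbsoluteValue K ℝ}
    (hw : IsNonarchimedean w) {π : K} (hπ : IsUniformizerAt w π) :
    IsDiscreteValuationRing (absValuationSubring hw) := by
  have key : ∀ x : absValuationSubring hw, x ≠ 0 → ∃ n : ℕ, w x = w π ^ n := fun x hx => by
    obtain ⟨m, hm⟩ := hπ.exists_zpow x fun h => hx (Subtype.ext h)
    have h2 : 0 ≤ m := by
      by_contra hneg
      have h3 : w x ≤ 1 := x.2
      rw [hm] at h3
      exact absurd h3 (not_le.mpr (one_lt_zpow_of_neg₀ hπ.pos hπ.lt_one (by omega)))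
    obtain ⟨n, rfl⟩ := Int.eq_ofNat_of_zero_le h2
    exact ⟨n, by rw [hm, zpow_natCast]⟩
  let p : absValuationSubring hw := ⟨π, hπ.lt_one.le⟩
  refine IsDiscreteValuationRing.ofHasUnitMulPowIrreducibleFactorization ⟨p, ⟨fun hu => ?_, ?_⟩, ?_⟩
  · obtain ⟨y, hy⟩ := hu.exists_right_inv
    have h1 : π * (y : K) = 1 := congrArg Subtype.val hy
    have h2 := congrArg w h1
    rw [map_mul, map_one] at h2
    have h3 : w y ≤ 1 := y.2
    nlinarith [hπ.pos, hπ.lt_one, w.nonneg y]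
  · intro a b hab
    have hab' : π = a * b := congrArg Subtype.val hab
    have ha : a ≠ 0 := by rintro rfl; exact hπ.ne_zero (by simpa using hab')
    have hb : b ≠ 0 := by rintro rfl; exact hπ.ne_zero (by simpa using hab')
    obtain ⟨m, hm⟩ := key a ha
    obtain ⟨n, hn⟩ := key b hb
    have h1 : w π ^ 1 = w π ^ (m + n) := by rw [pow_one, pow_add, ← hm, ← hn, ← map_mul, ← hab']
    have h2 := pow_right_injective₀ hπ.pos hπ.lt_one.ne h1
    rcases Nat.eq_zero_or_pos m with rfl | hm0
    · exact Or.inl (isUnit_absValuationSubring hw (by simpa using hm))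
    · obtain rfl : n = 0 := by omega
      exact Or.inr (isUnit_absValuationSubring hw (by simpa using hn))
  · intro x hx
    obtain ⟨n, hn⟩ := key x hx
    have hne : w π ^ n ≠ 0 := pow_ne_zero _ hπ.pos.ne'
    have h1 : w ((x : K) / π ^ n) = 1 := by rw [map_div₀, map_pow, hn, div_self hne]
    let y : absValuationSubring hw := ⟨(x : K) / π ^ n, h1.le⟩
    refine ⟨n, (isUnit_absValuationSubring hw (x := y) h1).unit, Subtype.ext ?_⟩
    exact mul_div_cancel₀ _ (pow_ne_zero _ hπ.ne_zero)

/-- A nonarchimedean place with discrete value group and finite residue field. -/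
structure Place.IsLocal (P : Place K) : Prop where
  not_isArchimedean : ¬ P.IsArchimedean
  exists_uniformizer : ∃ π, IsUniformizerAt P.rep π
  norm_pos : 0 < P.norm

theorem Place.IsLocal.isNonarchimedean {P : Place K} (h : P.IsLocal) : IsNonarchimedean P.rep :=
  P.isNonarchimedean_rep h.not_isArchimedean

/-- Positivity of the norm expresses finiteness of the residue field, since `Nat.card` of an
infinite type is 0. -/
theorem IsCenter.isLocal {R : Type*} [CommRing R] [IsDedekindDomain R] [Algebra R K]
    [IsFractionRing R K] {v : HeightOneSpectrum R} {P : Place K} (h : IsCenter v P.rep)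
    (hfin : Finite (R ⧸ v.asIdeal)) : P.IsLocal := by
  obtain ⟨π, hπ⟩ := v.valuation_exists_uniformizer K
  refine ⟨not_isArchimedean_of_rep h.isNonarchimedean, ⟨π, h.isUniformizerAt hπ⟩, ?_⟩
  rw [h.norm_eq]
  exact_mod_cast Nat.card_pos

variable (L) in
-- Apply the identity for Dedekind domains to the discrete valuation ring A of P and its integral
-- closure in L, which is finite over A by separability. No global ring of integers is involved, so
-- places at infinity are covered.
theorem Place.IsLocal.exists_fundamental_identity [FiniteDimensional K L]
    [Algebra.IsSeparable K L] {P : Place K} (hP : P.IsLocal) :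
    ∃ s : Finset (Place L), (∀ Q, Q ∈ s ↔ Q.LiesOver P) ∧ (∀ Q ∈ s, Q.IsLocal) ∧
      ∃ f : Place L → ℕ, (∀ Q ∈ s, Q.norm = P.norm ^ f Q) ∧
        ∑ Q ∈ s, Q.ramificationIndex K * f Q = Module.finrank K L := by
  have hw := hP.isNonarchimedean
  obtain ⟨π, hπ⟩ := hP.exists_uniformizer
  let A := absValuationSubring hw
  have : IsDiscreteValuationRing A := isDiscreteValuationRing_absValuationSubring hw hπ
  obtain ⟨v, hv⟩ := exists_isCenter (R := A) hw P.rep_isNontrivial fun r => r.2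
  let B := integralClosure A L
  have : IsDedekindDomain B := integralClosure.isDedekindDomain A K L
  have : IsFractionRing B L := integralClosure.isFractionRing_of_finite_extension K L
  have : Module.Finite A B := IsIntegralClosure.finite A K L B
  have : FaithfulSMul A L := by
    rw [faithfulSMul_iff_algebraMap_injective, IsScalarTower.algebraMap_eq A K L]
    exact (algebraMap K L).injective.comp (IsFractionRing.injective A K)
  have : Module.IsTorsionFree A B := inferInstance
  obtain ⟨s, hs, hc, f, hf, hsum⟩ := GlobalField.exists_fundamental_identity L B hv
  refine ⟨s, hs, fun Q hQ => ?_, f, hf, hsum⟩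
  obtain ⟨V, hV⟩ := hc Q hQ
  obtain ⟨ϖ, hϖ⟩ := V.valuation_exists_uniformizer L
  refine ⟨not_isArchimedean_of_rep hV.isNonarchimedean, ⟨ϖ, hV.isUniformizerAt hϖ⟩, ?_⟩
  rw [hf Q hQ]
  exact pow_pos hP.norm_pos _

end DiscretePlaces

/-! ### Places in extensions of global fields -/

section Global

open IsDedekindDomain Polynomial

variable (K : Type u) {L : Type v} [Field K] [Field L] [Algebra K L]

/-- The place of `K` below a place of `L`. -/
def Place.below [Algebra.IsAlgebraic K L] (Q : Place L) : Place K :=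
  Place.mk (restrict K Q.rep) (restrict_isNontrivial Q.rep_isNontrivial)

variable {K}

theorem below_eq_iff [Algebra.IsAlgebraic K L] {Q : Place L} {P : Place K} :
    Q.below K = P ↔ Q.LiesOver P :=
  ⟨fun h => ⟨restrict_isNontrivial Q.rep_isNontrivial, h⟩, fun ⟨_, h⟩ => h⟩

variable (K) in
theorem rep_below_isEquiv [Algebra.IsAlgebraic K L] (Q : Place L) :
    (Q.below K).rep.IsEquiv (restrict K Q.rep) := isEquiv_rep_mk _

theorem isNonarchimedean_iff_of_isEquiv {w w' : AbsoluteValue K ℝ} (h : w.IsEquiv w') :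
    IsNonarchimedean w ↔ IsNonarchimedean w' :=
  ⟨fun hw => isNonarchimedean_of_isEquiv hw h, fun hw => isNonarchimedean_of_isEquiv hw h.symm⟩

variable (K) in
theorem isArchimedean_below_iff [Algebra.IsAlgebraic K L] (Q : Place L) :
    (Q.below K).IsArchimedean ↔ Q.IsArchimedean := by
  rw [isArchimedean_iff_rep, isArchimedean_iff_rep,
    isNonarchimedean_iff_of_isEquiv (rep_below_isEquiv K Q), ← isNonarchimedean_iff_restrict]

variable (K) in
/-- Every nonarchimedean place of `K` is discrete with finite residue field, and every element of
`K` has finitely many nonarchimedean poles. -/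
structure IsGlobal : Prop where
  isLocal : ∀ P : Place K, ¬ P.IsArchimedean → P.IsLocal
  finite_poles : ∀ x : K, {P : Place K | ¬ P.IsArchimedean ∧ 1 < P.rep x}.Finite

variable (L) in
theorem IsGlobal.finite_below_mem (hK : IsGlobal K) [FiniteDimensional K L]
    [Algebra.IsSeparable K L] {S : Set (Place K)} (hS : S.Finite) :
    {Q : Place L | ¬ Q.IsArchimedean ∧ Q.below K ∈ S}.Finite := by
  refine (hS.biUnion (t := fun P => {Q : Place L | ¬ Q.IsArchimedean ∧ Q.below K = P})
    fun P _ => ?_).subset fun Q hQ => ?_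
  · by_cases hP : P.IsArchimedean
    · refine Set.Finite.subset Set.finite_empty fun Q hQ => ?_
      rw [← hQ.2, isArchimedean_below_iff] at hP
      exact hQ.1 hP
    · obtain ⟨s, hs, -⟩ := (hK.isLocal P hP).exists_fundamental_identity L
      exact s.finite_toSet.subset fun Q hQ => (hs Q).mpr (below_eq_iff.mp hQ.2)
  · exact Set.mem_biUnion hQ.2 ⟨hQ.1, rfl⟩

theorem IsGlobal.finite_coeff_poles (hK : IsGlobal K) (f : K[X]) :
    {P : Place K | ¬ P.IsArchimedean ∧ ∃ i, 1 < P.rep (f.coeff i)}.Finite := by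
  refine (f.support.finite_toSet.biUnion
    (t := fun i => {P : Place K | ¬ P.IsArchimedean ∧ 1 < P.rep (f.coeff i)})
    fun i _ => hK.finite_poles _).subset ?_
  rintro P ⟨hP, i, hi⟩
  refine Set.mem_biUnion (x := i) ?_ ⟨hP, hi⟩
  rw [Finset.mem_coe, mem_support_iff]
  intro h
  rw [h, map_zero] at hi
  exact absurd hi (by norm_num)

variable (L) in
-- If the coefficients of the minimal polynomial of x are integral at the place below Q, then x is
-- integral at Q. Poles of x thus lie over finitely many places, each with a finite fibre.
theorem IsGlobal.extension (hK : IsGlobal K) [FiniteDimensional K L]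
    [Algebra.IsSeparable K L] : IsGlobal L := by
  refine ⟨fun Q hQ => ?_, fun x => ?_⟩
  · have hP := hK.isLocal (Q.below K) (by rwa [isArchimedean_below_iff])
    obtain ⟨s, hs, hloc, -⟩ := hP.exists_fundamental_identity L
    exact hloc Q ((hs Q).mpr (below_eq_iff.mp rfl))
  · refine (hK.finite_below_mem L (hK.finite_coeff_poles (minpoly K x))).subset ?_
    rintro Q ⟨hQ, hx⟩
    refine ⟨hQ, by rwa [isArchimedean_below_iff], ?_⟩
    by_contra! hle
    have hna := Q.isNonarchimedean_rep hQ
    have := isUltrametricDist_withAbs hna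
    refine absurd hx (not_lt.mpr (norm_le_one_of_eval_eq_zero (F := WithAbs Q.rep)
      (x := WithAbs.toAbs Q.rep x) (p := (minpoly K x).map
        ((WithAbs.equiv Q.rep).symm.toRingHom.comp (algebraMap K L)))
      ((minpoly.monic (Algebra.IsIntegral.isIntegral x)).map _) (fun i => ?_) ?_))
    · rw [coeff_map]
      exact ((rep_below_isEquiv K Q).le_one_iff).mp (hle i)
    · rw [eval_map]
      have := congrArg (WithAbs.equiv Q.rep).symm.toRingHom (minpoly.aeval K x)
      rwa [aeval_def, hom_eval₂, map_zero] at this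

variable (K) in
theorem IsGlobal.exists_ramificationExponent_eq (hL : IsGlobal L) [FiniteDimensional K L]
    [Algebra.IsSeparable K L] {Q : Place L} (hQ : ¬ Q.IsArchimedean) :
    ∃ d : ℕ, HasDifferentExponentAt K Q.rep d ∧ Q.ramificationExponent K = d := by
  obtain ⟨π, hπ⟩ := (hL.isLocal Q hQ).exists_uniformizer
  obtain ⟨d, hd⟩ := exists_hasDifferentExponentAt (K := K) (Q.isNonarchimedean_rep hQ)
    (restrict_isNontrivial Q.rep_isNontrivial) hπ
  exact ⟨d, hd, ramificationExponent_eq hQ hd⟩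

variable (K L) in
-- For a primitive element α with minimal polynomial f, the different is trivial wherever f has
-- integral coefficients and δ = f'(α) is a unit. Separability gives δ ≠ 0, so the exceptions lie
-- over poles of coefficients of f or are poles of δ or δ⁻¹.
theorem IsGlobal.finite_ramification (hK : IsGlobal K) [FiniteDimensional K L]
    [Algebra.IsSeparable K L] :
    {Q : Place L | ¬ Q.IsArchimedean ∧ Q.ramificationExponent K ≠ 0}.Finite := by
  have hL := hK.extension L
  obtain ⟨α, hα⟩ := exists_adjoin_eq_top K L
  set δ := aeval α (derivative (minpoly K α))
  have hδ : δ ≠ 0 := (Algebra.IsSeparable.isSeparable K α).aeval_derivative_ne_zero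
    (minpoly.aeval K α)
  refine ((hK.finite_below_mem L (hK.finite_coeff_poles (minpoly K α))).union
    ((hL.finite_poles δ).union (hL.finite_poles δ⁻¹))).subset ?_
  rintro Q ⟨hQ, hr⟩
  by_contra hcon
  simp only [Set.mem_union, Set.mem_ofPred_eq, not_or, hQ, isArchimedean_below_iff, not_false_iff,
    true_and, not_exists, not_lt, map_inv₀] at hcon
  obtain ⟨h1, h2, h3⟩ := hcon
  rw [inv_le_one₀ (Q.rep.pos hδ)] at h3
  obtain ⟨d, hd, hrd⟩ := hL.exists_ramificationExponent_eq K hQ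
  refine hr ?_
  rw [hrd, hd.eq_zero (Q.isNonarchimedean_rep hQ) (restrict_isNontrivial Q.rep_isNontrivial) hα
    (fun i => ((rep_below_isEquiv K Q).le_one_iff).mp (h1 i)) (le_antisymm h2 h3), Nat.cast_zero]

/-- Transitivity of the different exponent at nonarchimedean places. -/
theorem IsGlobal.ramificationExponent_tower (hL : IsGlobal L) [FiniteDimensional K L]
    [Algebra.IsSeparable K L] {M : Type*} [Field M] [Algebra K M] [Algebra L M]
    [IsScalarTower K L M] [FiniteDimensional L M] [Algebra.IsSeparable L M] {R : Place M}
    (hR : ¬ R.IsArchimedean) :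
    R.ramificationExponent K = R.ramificationExponent L +
      R.ramificationIndex L * (R.below L).ramificationExponent K := by
  have := FiniteDimensional.trans K L M
  have hM := hL.extension M
  have hQ : ¬ (R.below L).IsArchimedean := by rwa [isArchimedean_below_iff]
  obtain ⟨d₁, hd₁, hr₁⟩ := hL.exists_ramificationExponent_eq K hQ
  obtain ⟨d₂, hd₂, hr₂⟩ := hM.exists_ramificationExponent_eq L hR
  obtain ⟨π, hπ⟩ := (hL.isLocal _ hQ).exists_uniformizer
  obtain ⟨ϖ, hϖ⟩ := (hM.isLocal _ hR).exists_uniformizer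
  have hπ' := hπ.of_isEquiv (rep_below_isEquiv L R)
  obtain ⟨e, he⟩ := exists_pow_eq hπ' hϖ
  have := HasDifferentExponentAt.tower (R.isNonarchimedean_rep hR)
    (restrict_isNontrivial R.rep_isNontrivial) (hd₁.of_isEquiv (rep_below_isEquiv L R)) hd₂ hπ' hϖ he
  rw [ramificationExponent_eq hR this, hr₁, hr₂, ramificationIndex_eq hR hπ' hϖ he]
  push_cast
  ring

end Global

/-! ### The rational base fields -/

section Base

open IsDedekindDomain Polynomial

theorem IsCenter.finite_poles {R : Type*} {K : Type u} [CommRing R] [IsDedekindDomain R] [Field K]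
    [Algebra R K] [IsFractionRing R K] (x : K) :
    {P : Place K | (∃ v : HeightOneSpectrum R, IsCenter v P.rep) ∧ 1 < P.rep x}.Finite := by
  refine ((HeightOneSpectrum.Support.finite R x).image
    fun v => Place.mk _ (adicAbv_isNontrivial (K := K) v)).subset ?_
  rintro P ⟨⟨v, hv⟩, hx⟩
  refine ⟨v, ?_, ?_⟩
  · exact not_le.mp fun h => absurd hx (not_lt.mpr ((hv.le_one_iff x).mpr h))
  · dsimp only
    rw [← P.mk_rep]
    exact mk_eq_mk_iff.mpr hv.isEquiv_adicAbv

theorem intCast_le_one {K : Type u} [Field K] {w : AbsoluteValue K ℝ} (hw : IsNonarchimedean w)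
    (n : ℤ) : w n ≤ 1 := by
  have := isUltrametricDist_withAbs hw
  have := IsUltrametricDist.norm_intCast_le_one (WithAbs w) n
  rwa [← map_intCast (WithAbs.equiv w) n]

theorem isGlobal_rat : IsGlobal ℚ := by
  have key : ∀ P : Place ℚ, ¬ P.IsArchimedean → ∃ v : HeightOneSpectrum ℤ, IsCenter v P.rep :=
    fun P hP => exists_isCenter (P.isNonarchimedean_rep hP) P.rep_isNontrivial fun n =>
      intCast_le_one (P.isNonarchimedean_rep hP) n
  refine ⟨fun P hP => ?_, fun x => ?_⟩
  · obtain ⟨v, hv⟩ := key P hP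
    exact hv.isLocal (Ideal.finiteQuotientOfFreeOfNeBot v.asIdeal v.ne_bot)
  · exact (IsCenter.finite_poles (R := ℤ) x).subset fun P hP => ⟨key P hP.1, hP.2⟩

variable {F : Type u} [Field F] [Finite F]

/-- Nonzero elements of a finite field are roots of unity. -/
theorem apply_eq_one_of_finite {K : Type*} [Field K] [Algebra F K] (w : AbsoluteValue K ℝ) {a : F}
    (ha : a ≠ 0) : w (algebraMap F K a) = 1 := by
  have := Fintype.ofFinite F
  have h := congrArg (fun b => w (algebraMap F K b)) (FiniteField.pow_card_sub_one_eq_one a ha)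
  simp only [map_pow, map_one] at h
  exact (pow_eq_one_iff_of_nonneg (w.nonneg _)
    (by have := Fintype.one_lt_card (α := F); omega)).mp h

theorem apply_le_one_of_finite {K : Type*} [Field K] [Algebra F K] (w : AbsoluteValue K ℝ) (a : F) :
    w (algebraMap F K a) ≤ 1 := by
  rcases eq_or_ne a 0 with rfl | ha
  · simp
  · exact (apply_eq_one_of_finite w ha).le

theorem isNonarchimedean_of_finite {K : Type*} [Field K] [Algebra F K] (w : AbsoluteValue K ℝ) :
    IsNonarchimedean w := isNonarchimedean_of_natCast_le_one fun n => by
  rw [← map_natCast (algebraMap F K)]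
  exact apply_le_one_of_finite w _

theorem not_isArchimedean_of_finite (F : Type*) [Field F] [Finite F] {K : Type*} [Field K]
    [Algebra F K] (P : Place K) : ¬ P.IsArchimedean :=
  not_isArchimedean_of_rep (isNonarchimedean_of_finite (F := F) _)

/-- An absolute value trivial on constants with value greater than 1 at X sees only the degree;
hence there is exactly one such class, the place at infinity. -/
theorem eq_zpow_intDegree {w : AbsoluteValue (RatFunc F) ℝ} (hX : 1 < w RatFunc.X) {f : RatFunc F}
    (hf : f ≠ 0) : w f = w RatFunc.X ^ f.intDegree := by
  have := isUltrametricDist_withAbs (isNonarchimedean_of_finite (F := F) w)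
  let v : Valuation (RatFunc F) NNReal :=
    (NormedField.valuation (K := WithAbs w)).comap (WithAbs.equiv w).symm.toRingHom
  have hv : ∀ x, (v x : ℝ) = w x := fun x => rfl
  have : v.IsTrivialOn F := ⟨fun a ha => NNReal.coe_injective (apply_eq_one_of_finite w ha)⟩
  have h1 : 1 < v RatFunc.X := by exact_mod_cast (hv RatFunc.X).symm ▸ hX
  have h2 := RatFunc.valuation_eq_valuation_X_zpow_intDegree_of_one_lt_valuation_X h1 hf
  rw [← hv, ← hv, h2, NNReal.coe_zpow]

theorem isUniformizerAt_X_inv {w : AbsoluteValue (RatFunc F) ℝ} (hX : 1 < w RatFunc.X) :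
    IsUniformizerAt w RatFunc.X⁻¹ := by
  refine ⟨inv_ne_zero RatFunc.X_ne_zero, ?_, fun x hx => ⟨-x.intDegree, ?_⟩⟩
  · rw [map_inv₀]; exact inv_lt_one_of_one_lt₀ hX
  · rw [map_inv₀, inv_zpow', neg_neg]; exact eq_zpow_intDegree hX hx

theorem isEquiv_of_one_lt_X {w w' : AbsoluteValue (RatFunc F) ℝ} (hX : 1 < w RatFunc.X)
    (hX' : 1 < w' RatFunc.X) : w.IsEquiv w' := by
  refine AbsoluteValue.isEquiv_of_lt_one_imp (isUniformizerAt_X_inv hX).isNontrivial fun f hf => ?_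
  rcases eq_or_ne f 0 with rfl | h0
  · simp
  · rw [eq_zpow_intDegree hX h0, zpow_lt_one_iff_right₀ hX] at hf
    rwa [eq_zpow_intDegree hX' h0, zpow_lt_one_iff_right₀ hX']

/-- The residue field at infinity is F: for f of degree 0, subtracting the leading coefficient of
the numerator (the denominator is monic) lowers the degree. -/
theorem exists_sub_C_lt_one {w : AbsoluteValue (RatFunc F) ℝ} (hX : 1 < w RatFunc.X)
    {f : RatFunc F} (hf : w f ≤ 1) : ∃ c : F, w (f - algebraMap F (RatFunc F) c) < 1 := by
  rcases hf.lt_or_eq with hlt | heq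
  · exact ⟨0, by simpa using hlt⟩
  have hf0 : f ≠ 0 := by rintro rfl; simp at heq
  have hdeg : f.intDegree = 0 := by
    rw [eq_zpow_intDegree hX hf0] at heq
    exact (zpow_eq_one_iff_right₀ (w.nonneg _) hX.ne').mp heq
  have hden := f.denom_ne_zero
  have hnum := RatFunc.num_ne_zero hf0
  have hnd : f.num.natDegree = f.denom.natDegree := by
    rw [RatFunc.intDegree] at hdeg; omega
  set c := f.num.leadingCoeff
  set g := f.num - C c * f.denom
  refine ⟨c, ?_⟩
  have hfg : f - algebraMap F (RatFunc F) c =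
      algebraMap F[X] (RatFunc F) g / algebraMap F[X] (RatFunc F) f.denom := by
    have hd : algebraMap F[X] (RatFunc F) f.denom ≠ 0 := RatFunc.algebraMap_ne_zero hden
    rw [eq_div_iff hd, sub_mul, map_sub, map_mul]
    congr 1
    nth_rewrite 1 [← RatFunc.num_div_denom f]
    exact div_mul_cancel₀ _ hd
  rcases eq_or_ne g 0 with hg | hg
  · rw [hfg, hg]; simp
  have hlt : g.natDegree < f.num.natDegree := by
    refine natDegree_lt_natDegree hg (degree_sub_lt_left ?_ hnum ?_)
    · rw [degree_C_mul (leadingCoeff_ne_zero.mpr hnum), degree_eq_natDegree hnum,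
        degree_eq_natDegree hden, hnd]
    · rw [leadingCoeff_mul, leadingCoeff_C, (RatFunc.monic_denom f).leadingCoeff, mul_one]
  rw [hfg, eq_zpow_intDegree hX (div_ne_zero (RatFunc.algebraMap_ne_zero hg)
    (RatFunc.algebraMap_ne_zero hden)), zpow_lt_one_iff_right₀ hX,
    RatFunc.intDegree_div (RatFunc.algebraMap_ne_zero hg) (RatFunc.algebraMap_ne_zero hden),
    RatFunc.intDegree_polynomial, RatFunc.intDegree_polynomial]
  omega

theorem finite_quotient_of_ne_bot {I : Ideal F[X]} (hI : I ≠ ⊥) : Finite (F[X] ⧸ I) := by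
  obtain ⟨f, hf, hf0⟩ := Submodule.exists_mem_ne_zero_of_ne_bot hI
  have : Finite (degreeLT F f.natDegree) := Finite.of_equiv _ (degreeLTEquiv F _).symm.toEquiv
  refine Finite.of_surjective
    (fun g : degreeLT F f.natDegree => Ideal.Quotient.mk I (g : F[X])) fun y => ?_
  obtain ⟨g, rfl⟩ := Ideal.Quotient.mk_surjective y
  refine ⟨⟨g % f, mem_degreeLT.mpr ?_⟩, ?_⟩
  · rw [← degree_eq_natDegree hf0]
    exact EuclideanDomain.mod_lt g hf0
  · refine (Ideal.Quotient.mk_eq_mk_iff_sub_mem _ _).mpr ?_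
    have h : g % f - g = -(f * (g / f)) := by
      rw [EuclideanDomain.mod_eq_sub_mul_div, sub_sub_cancel_left]
    exact h ▸ I.neg_mem (I.mul_mem_right _ hf)

/-- A place with |X| ≤ 1 is centered at a prime of F[X]; the places with |X| > 1 form a single
class, with residue field F. -/
theorem isGlobal_ratFunc : IsGlobal (RatFunc F) := by
  have hna : ∀ P : Place (RatFunc F), IsNonarchimedean P.rep := fun P =>
    isNonarchimedean_of_finite (F := F) _
  have key : ∀ P : Place (RatFunc F), P.rep RatFunc.X ≤ 1 →
      ∃ v : HeightOneSpectrum F[X], IsCenter v P.rep := fun P hP =>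
    exists_isCenter (R := F[X]) (hna P) P.rep_isNontrivial fun f => by
      have := isUltrametricDist_withAbs (hna P)
      have h := norm_eval_le_one (F := WithAbs P.rep) (x := WithAbs.toAbs P.rep RatFunc.X)
        (p := f.map ((WithAbs.equiv P.rep).symm.toRingHom.comp (algebraMap F (RatFunc F))))
        (fun i => by rw [coeff_map]; exact apply_le_one_of_finite (F := F) P.rep (f.coeff i)) hP
      rw [eval_map] at h
      have h2 := hom_eval₂ f (algebraMap F (RatFunc F)) (WithAbs.equiv P.rep).symm.toRingHom
        RatFunc.X
      have h3 : f.eval₂ (algebraMap F (RatFunc F)) RatFunc.X = algebraMap F[X] (RatFunc F) f := by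
        rw [← aeval_def, ← RatFunc.algebraMap_X (K := F), aeval_algebraMap_apply,
          aeval_X_left_apply]
      rw [h3] at h2
      exact (congrArg norm h2).trans_le h
  refine ⟨fun P hP => ?_, fun x => ?_⟩
  · rcases le_or_gt (P.rep RatFunc.X) 1 with h | h
    · obtain ⟨v, hv⟩ := key P h
      exact hv.isLocal (finite_quotient_of_ne_bot v.ne_bot)
    · refine ⟨hP, ⟨_, isUniformizerAt_X_inv h⟩, ?_⟩
      rw [Place.norm, dif_neg hP, natCard_residueField (S := F) (P.isNonarchimedean_rep hP)
        (apply_le_one_of_finite _) ⊥ (fun a => ?_) fun x hx => exists_sub_C_lt_one h hx]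
      · have : Finite (F ⧸ (⊥ : Ideal F)) := Finite.of_surjective _ Ideal.Quotient.mk_surjective
        exact_mod_cast Nat.card_pos
      · rw [Ideal.mem_bot]
        refine ⟨by rintro rfl; simp, fun h => ?_⟩
        by_contra ha
        exact h.ne (apply_eq_one_of_finite _ ha)
  · have hinf : {P : Place (RatFunc F) | 1 < P.rep RatFunc.X}.Subsingleton := fun P hP Q hQ => by
      rw [← P.mk_rep, ← Q.mk_rep]
      exact mk_eq_mk_iff.mpr (isEquiv_of_one_lt_X hP hQ)
    refine ((IsCenter.finite_poles (R := F[X]) x).union hinf.finite).subset fun P hP => ?_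
    rcases le_or_gt (P.rep RatFunc.X) 1 with h | h
    · exact Or.inl ⟨key P h, hP.2⟩
    · exact Or.inr h

end Base

/-! ### Archimedean places of number fields -/

section Archimedean

open NumberField Polynomial Module
open scoped NumberField.LiesOver

variable {K : Type u} {L : Type v} [Field K] [Field L] [Algebra K L]

/-- The place defined by an infinite place of a number field. -/
def placeOfInfinite (v : InfinitePlace K) : Place K := Place.mk v.1 v.isNontrivial

theorem placeOfInfinite_injective : Function.Injective (placeOfInfinite (K := K)) := fun _ _ h =>
  InfinitePlace.eq_iff_isEquiv.mpr (mk_eq_mk_iff.mp h)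

theorem rep_placeOfInfinite (v : InfinitePlace K) : (placeOfInfinite v).rep.IsEquiv v.1 :=
  isEquiv_rep_mk _

theorem isArchimedean_placeOfInfinite (v : InfinitePlace K) :
    (placeOfInfinite v).IsArchimedean := by
  refine ⟨v.1, v.isNontrivial, rfl, 1, 1, ?_⟩
  have h : v.1 ((2 : ℕ) : K) = 2 := by
    rw [← InfinitePlace.coe_apply, v.map_natCast]; rfl
  rw [map_one, max_self, one_add_one_eq_two, ← Nat.cast_two, h]
  norm_num

/-- Otherwise weak approximation gives an element a with w a > 1 that is less than 1 at every
infinite place. The minimal polynomials of the powers of a then have bounded rational coefficients,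
and Cauchy's root bound keeps w (a ^ n) bounded in n, a contradiction. -/
theorem exists_isEquiv_infinitePlace [NumberField K] {w : AbsoluteValue K ℝ}
    (hw : ¬ IsNonarchimedean w) : ∃ v : InfinitePlace K, w.IsEquiv v.1 := by
  by_contra! hne
  have hnt : w.IsNontrivial := by
    by_contra h
    refine hw (isNonarchimedean_of_natCast_le_one fun n => ?_)
    by_contra hn
    refine h ⟨n, fun h0 => hn ?_, fun h1 => hn h1.le⟩
    rw [h0, map_zero]; exact zero_le_one
  -- By Ostrowski over ℚ, w restricts to a power |·| ^ c of the usual absolute value; this turns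
  -- bounds on rational coefficients into bounds for w.
  have hreal : (restrict ℚ w).IsEquiv Rat.AbsoluteValue.real := by
    refine Rat.AbsoluteValue.equiv_real_of_unbounded fun hbdd => hw ?_
    exact isNonarchimedean_iff_restrict.mpr (isNonarchimedean_of_natCast_le_one hbdd)
  obtain ⟨c, hc, hcw⟩ := AbsoluteValue.isEquiv_iff_exists_rpow_eq.mp hreal.symm
  let V : Option (InfinitePlace K) → AbsoluteValue K ℝ := fun o => o.elim w (·.1)
  obtain ⟨a, ha, hlt⟩ := AbsoluteValue.exists_one_lt_lt_one_pi_of_not_isEquiv (v := V)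
    (by rintro (_ | v); exacts [hnt, v.isNontrivial])
    (by
      rintro (_ | v) (_ | v') hvv'
      · exact absurd rfl hvv'
      · exact hne v'
      · exact fun h => hne v h.symm
      · exact fun h => hvv' (congrArg some (InfinitePlace.eq_iff_isEquiv.mpr h))) none
  have hemb : ∀ (n : ℕ) (φ : K →+* ℂ), ‖φ (a ^ n)‖ ≤ 1 := fun n φ => by
    rw [map_pow, norm_pow]
    exact pow_le_one₀ (norm_nonneg _) (hlt (some (InfinitePlace.mk φ)) (by simp)).le
  -- The coefficients are elementary symmetric functions of conjugates of absolute value at most 1,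
  -- so a central binomial coefficient bounds them independently of n.
  set C : ℝ := Nat.cast ((finrank ℚ K).choose (finrank ℚ K / 2))
  have hbound : ∀ n, w a ^ n ≤ C ^ c + 1 := fun n => by
    have hcoeff : ∀ i, |(((minpoly ℚ (a ^ n)).coeff i : ℚ) : ℝ)| ≤ C := fun i => by
      have := Embeddings.coeff_bdd_of_norm_le (hemb n) i
      rw [max_self, one_pow, one_mul] at this
      exact this
    have hmon : (minpoly ℚ (a ^ n)).Monic := minpoly.monic (Algebra.IsIntegral.isIntegral _)
    let f := (minpoly ℚ (a ^ n)).map ((WithAbs.equiv w).symm.toRingHom.comp (algebraMap ℚ K))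
    have hfm : f.Monic := hmon.map _
    have hroot : f.IsRoot (WithAbs.toAbs w (a ^ n)) := by
      rw [IsRoot, eval_map]
      have := congrArg (WithAbs.equiv w).symm.toRingHom (minpoly.aeval ℚ (a ^ n))
      rwa [aeval_def, hom_eval₂, map_zero] at this
    have h1 := hroot.norm_lt_cauchyBound hfm.ne_zero
    have hC : (0 : ℝ) ≤ C ^ c := by positivity
    have h2 : f.cauchyBound ≤ Real.toNNReal (C ^ c) + 1 := by
      rw [cauchyBound, hfm.leadingCoeff, nnnorm_one, div_one]
      gcongr
      refine Finset.sup_le fun i _ => ?_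
      rw [coeff_map, ← NNReal.coe_le_coe, Real.coe_toNNReal _ hC]
      refine (congrFun hcw _).symm.trans_le ?_
      exact Real.rpow_le_rpow (abs_nonneg _) (hcoeff i) hc.le
    rw [← map_pow]
    have h3 := NNReal.coe_le_coe.mpr h2
    rw [NNReal.coe_add, Real.coe_toNNReal _ hC] at h3
    exact ((NNReal.coe_lt_coe.mpr h1).trans_le h3).le
  obtain ⟨n, hn⟩ := pow_unbounded_of_one_lt (C ^ c + 1) ha
  exact absurd (hbound n) (not_le.mpr hn)

theorem exists_placeOfInfinite_eq [NumberField K] {P : Place K} (hP : P.IsArchimedean) :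
    ∃ v, placeOfInfinite v = P := by
  obtain ⟨v, hv⟩ := exists_isEquiv_infinitePlace (isArchimedean_iff_rep.mp hP)
  exact ⟨v, by rw [← P.mk_rep]; exact mk_eq_mk_iff.mpr hv.symm⟩

variable (K) in
theorem finite_isArchimedean [NumberField K] : {P : Place K | P.IsArchimedean}.Finite :=
  (Set.finite_range placeOfInfinite).subset fun _ hP => exists_placeOfInfinite_eq hP

theorem placeOfInfinite_liesOver_iff [Algebra.IsAlgebraic K L] {v : InfinitePlace K}
    {w : InfinitePlace L} : (placeOfInfinite w).LiesOver (placeOfInfinite v) ↔ w.LiesOver v := by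
  have h1 : (restrict K (placeOfInfinite w).rep).IsEquiv (w.comap (algebraMap K L)).1 :=
    restrict_isEquiv (rep_placeOfInfinite w)
  rw [liesOver_iff]
  constructor
  · intro h
    have h2 := (h1.symm.trans h).trans (rep_placeOfInfinite v)
    exact ⟨congrArg Subtype.val (InfinitePlace.eq_iff_isEquiv.mpr h2)⟩
  · intro h
    have h2 : w.comap (algebraMap K L) = v := InfinitePlace.LiesOver.comap_eq w v
    rw [h2] at h1
    exact h1.trans (rep_placeOfInfinite v).symm

/-- Matches the completions attached to infinite places with the completions of the underlying
absolute values; the identifications commute with the extension maps because they do so on the dense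
subfield K. -/
theorem finrank_completion_infinitePlace (v : InfinitePlace K) (w : InfinitePlace L)
    [w.LiesOver v] :
    @finrank (restrict K w.1).Completion w.1.Completion _ _
      (completionNormedAlgebra K w.1).toModule = finrank v.Completion w.Completion := by
  have h : v.1.IsEquiv (restrict K w.1) := by
    rw [show restrict K w.1 = v.1 from AbsoluteValue.LiesOver.comp_eq w.1 v.1]; exact .rfl
  obtain ⟨σ, -, -, hσc, hσ, -⟩ := exists_completion_ringEquiv h
  let := completionNormedAlgebra K w.1
  refine (Algebra.finrank_eq_of_equiv_equiv ((InfinitePlace.Completion.equiv v).trans σ)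
    (InfinitePlace.Completion.equiv w) (RingHom.ext fun x => ?_)).symm
  refine InfinitePlace.Completion.induction_on v x (isClosed_eq ?_ ?_) fun a => ?_
  · exact (continuous_algebraMap_completion K w.1).comp
      (hσc.comp (InfinitePlace.Completion.continuous_toCompletion v))
  · exact (InfinitePlace.Completion.continuous_toCompletion w).comp
      NumberField.LiesOver.continuous_completionMap
  · refine Eq.trans (b := toCompletion w.1 (algebraMap K L a.ofAbs)) ?_ ?_
    · change algebraMap _ _ (σ (toCompletion v.1 a.ofAbs)) = _
      rw [hσ, algebraMap_toCompletion]
    · exact (congrArg (·.toCompletion) (NumberField.LiesOver.completionMap_coe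
        (v := v) (w := w) a)).symm

theorem ramificationIndex_placeOfInfinite (v : InfinitePlace K) (w : InfinitePlace L)
    [w.LiesOver v] : (placeOfInfinite w).ramificationIndex K = v.inertiaDeg w := by
  rw [Place.ramificationIndex, if_pos (isArchimedean_placeOfInfinite w),
    InfinitePlace.inertiaDeg_eq_finrank, ← finrank_completion_infinitePlace]
  exact finrank_completion_of_isEquiv (rep_placeOfInfinite w)

/-- The completion of ℚ embeds isometrically; its image is complete, hence closed, and is therefore
the closure of the prime field. -/
theorem finrank_topologicalClosure_bot [Algebra ℚ L] (w : AbsoluteValue L ℝ) :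
    finrank (⊥ : Subfield w.Completion).topologicalClosure w.Completion =
      @finrank (restrict ℚ w).Completion w.Completion _ _
        (completionNormedAlgebra ℚ w).toModule := by
  let := completionNormedAlgebra ℚ w
  set i := algebraMap (restrict ℚ w).Completion w.Completion
  have hi : Isometry i := (isometry_algebraMap ℚ w).completion_map
  have hmem : ∀ x, i x ∈ (⊥ : Subfield w.Completion).topologicalClosure := fun x => by
    refine (denseRange_toCompletion (restrict ℚ w)).induction_on x ?_ fun q => ?_
    · exact (Subfield.isClosed_topologicalClosure _).preimage hi.continuous
    · refine Subfield.le_topologicalClosure _ ?_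
      rw [show i (toCompletion (restrict ℚ w) q) = (q : w.Completion) from
        eq_ratCast (i.comp (toCompletion (restrict ℚ w))) q]
      exact SubfieldClass.ratCast_mem _ q
  have hle : (⊥ : Subfield w.Completion).topologicalClosure ≤ i.fieldRange :=
    Subfield.topologicalClosure_minimal _ bot_le (by
      rw [RingHom.coe_fieldRange]; exact hi.isClosedEmbedding.isClosed_range)
  let j : (restrict ℚ w).Completion ≃+* (⊥ : Subfield w.Completion).topologicalClosure :=
    RingEquiv.ofBijective (i.codRestrict _ hmem) ⟨fun x y hxy => hi.injective
      (congrArg Subtype.val hxy), fun y => by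
        obtain ⟨x, hx⟩ := hle y.2
        exact ⟨x, Subtype.ext hx⟩⟩
  exact (Algebra.finrank_eq_of_equiv_equiv j (.refl _) (RingHom.ext fun _ => rfl)).symm

theorem log_norm_eq [Algebra ℚ L] {Q : Place L} (hQ : Q.IsArchimedean) :
    Real.log Q.norm = Q.ramificationIndex ℚ := by
  rw [Place.norm, dif_pos hQ, Real.log_exp, finrank_topologicalClosure_bot,
    Place.ramificationIndex, if_pos hQ]

theorem mult_eq_one_rat (v : InfinitePlace ℚ) : v.mult = 1 := 
  InfinitePlace.IsReal.mult_eq_one (IsTotallyReal.isReal v)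

theorem log_norm_placeOfInfinite [NumberField L] (w : InfinitePlace L) :
    Real.log (placeOfInfinite w).norm = w.mult := by
  let v := w.comap (algebraMap ℚ L)
  have : w.LiesOver v := ⟨rfl⟩
  rw [log_norm_eq (isArchimedean_placeOfInfinite w), ramificationIndex_placeOfInfinite v w,
    InfinitePlace.inertiaDeg_eq_finrank, ← InfinitePlace.mult_mul_finrank v w, mult_eq_one_rat,
    one_mul]

end Archimedean

/-! ### Local degree formulas -/

section LocalDegree

open NumberField

/-- The local contributions at the place `P` of `K` to the degrees of the ramification divisors in
a tower `L / K / K₀` are compatible, with local degrees adding up to `[L : K]`. -/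
def TowerFormula (K₀ : Type*) {K : Type u} (L : Type v) [Field K₀] [Field K] [Field L]
    [Algebra K₀ K] [Algebra K₀ L] [Algebra K L] (P : Place K) : Prop :=
  ∃ s : Finset (Place L), (∀ Q, Q ∈ s ↔ Q.LiesOver P) ∧ ∃ n : Place L → ℕ,
    (∀ Q ∈ s, Q.norm ^ Q.ramificationExponent K₀ =
      Q.norm ^ Q.ramificationExponent K * (P.norm ^ P.ramificationExponent K₀) ^ n Q) ∧
    ∑ Q ∈ s, n Q = Module.finrank K L

theorem IsGlobal.towerFormula {K₀ : Type*} {K : Type u} (L : Type v) [Field K₀] [Field K] [Field L]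
    [Algebra K₀ K] [Algebra K₀ L] [Algebra K L] [IsScalarTower K₀ K L] [FiniteDimensional K₀ K]
    [Algebra.IsSeparable K₀ K] [FiniteDimensional K L] [Algebra.IsSeparable K L]
    (hK : IsGlobal K) {P : Place K} (hP : ¬ P.IsArchimedean) : TowerFormula K₀ L P := by
  have hpos := (hK.isLocal P hP).norm_pos
  obtain ⟨s, hs, hloc, f, hf, hsum⟩ := (hK.isLocal P hP).exists_fundamental_identity L
  refine ⟨s, hs, _, fun Q hQ => ?_, hsum⟩
  have hPQ : Q.below K = P := below_eq_iff.mpr ((hs Q).mp hQ)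
  rw [hK.ramificationExponent_tower (hloc Q hQ).not_isArchimedean, hPQ,
    Real.rpow_add (hloc Q hQ).norm_pos, hf Q hQ]
  congr 1
  rw [← Real.rpow_natCast, ← Real.rpow_natCast, ← Real.rpow_mul hpos.le, ← Real.rpow_mul hpos.le]
  congr 1
  push_cast
  ring

theorem norm_pos_of_isArchimedean {K : Type u} [Field K] {P : Place K} (hP : P.IsArchimedean) :
    0 < P.norm := by
  rw [Place.norm, dif_pos hP]
  exact Real.exp_pos _

theorem IsGlobal.norm_pos {K : Type u} [Field K] (hK : IsGlobal K) (P : Place K) : 0 < P.norm := by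
  by_cases hP : P.IsArchimedean
  · exact norm_pos_of_isArchimedean hP
  · exact (hK.isLocal P hP).norm_pos

variable {K : Type u} {L : Type v} [Field K] [Field L] [NumberField L] [Algebra K L]

theorem norm_placeOfInfinite (w : InfinitePlace L) : (placeOfInfinite w).norm = Real.exp w.mult := by
  rw [← log_norm_placeOfInfinite,
    Real.exp_log (norm_pos_of_isArchimedean (isArchimedean_placeOfInfinite w))]

theorem ramificationExponent_placeOfInfinite (v : InfinitePlace K) (w : InfinitePlace L)
    [w.LiesOver v] : (placeOfInfinite w).ramificationExponent K =
      if v.inertiaDeg w ≠ 1 then -Real.log w.mult else 0 := by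
  rw [Place.ramificationExponent, dif_pos (isArchimedean_placeOfInfinite w),
    ramificationIndex_placeOfInfinite v w, log_norm_placeOfInfinite]

/-- Over ℚ no case distinction is needed: in the unramified case the multiplicity is 1, with
logarithm 0. -/
theorem ramificationExponent_rat_placeOfInfinite (w : InfinitePlace L) :
    (placeOfInfinite w).ramificationExponent ℚ = -Real.log w.mult := by
  let v := w.comap (algebraMap ℚ L)
  have : w.LiesOver v := ⟨rfl⟩
  have h := InfinitePlace.mult_mul_finrank v w
  rw [mult_eq_one_rat, one_mul, ← InfinitePlace.inertiaDeg_eq_finrank] at h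
  rw [ramificationExponent_placeOfInfinite v w, h]
  split_ifs with h1
  · rfl
  · rw [not_not] at h1
    rw [h1]; simp

variable (L) in
-- The weights are the local degrees. If the local degree is 1, both places have the same
-- multiplicity and r_Q relative to K is 0. Otherwise P is real and contributes 1, while the two
-- exponents at Q agree.
theorem towerFormula_of_isArchimedean [NumberField K] {P : Place K} (hP : P.IsArchimedean) :
    TowerFormula ℚ L P := by
  classical
  obtain ⟨v, rfl⟩ := exists_placeOfInfinite_eq hP
  have hmem : ∀ w, w ∈ (v.placesOver L).toFinset ↔ w.LiesOver v := fun w => by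
    rw [Set.mem_toFinset]; rfl
  refine ⟨(v.placesOver L).toFinset.image placeOfInfinite, fun Q => ?_,
    fun Q => Q.ramificationIndex K, fun Q hQ => ?_, ?_⟩
  · rw [Finset.mem_image]
    constructor
    · rintro ⟨w, hw, rfl⟩
      exact placeOfInfinite_liesOver_iff.mpr ((hmem w).mp hw)
    · intro hQ
      have hQa : Q.IsArchimedean := by
        rwa [← isArchimedean_below_iff K, below_eq_iff.mpr hQ]
      obtain ⟨w, rfl⟩ := exists_placeOfInfinite_eq hQa
      exact ⟨w, (hmem w).mpr (placeOfInfinite_liesOver_iff.mp hQ), rfl⟩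
  · obtain ⟨w, hw, rfl⟩ := Finset.mem_image.mp hQ
    have := (hmem w).mp hw
    have h := InfinitePlace.mult_mul_finrank v w
    rw [← InfinitePlace.inertiaDeg_eq_finrank] at h
    dsimp only
    rw [ramificationIndex_placeOfInfinite v w, ramificationExponent_placeOfInfinite v w,
      ramificationExponent_rat_placeOfInfinite, ramificationExponent_rat_placeOfInfinite,
      norm_placeOfInfinite, norm_placeOfInfinite]
    rcases eq_or_ne (v.inertiaDeg w) 1 with he | he
    · rw [he, mul_one] at h
      rw [he, h]; simp
    -- The multiplicity of w is at most 2 and equals that of v times a local degree different from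
    -- 1.
    · have hv : v.mult = 1 := by
        have h1 := v.mult_pos
        have h2 := w.mult_pos
        have h3 : w.mult ≤ 2 := by rw [InfinitePlace.mult]; split_ifs <;> omega
        rcases Nat.lt_or_ge (v.inertiaDeg w) 2 with h4 | h4
        · have : v.inertiaDeg w = 0 := by omega
          rw [this] at h; omega
        · nlinarith
      rw [if_pos he, hv]; simp
  · rw [Finset.sum_image fun w _ w' _ h => placeOfInfinite_injective h,
      ← InfinitePlace.sum_inertiaDeg_eq_finrank K L v]
    refine Finset.sum_congr rfl fun w hw => ?_
    have := (hmem w).mp hw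
    exact ramificationIndex_placeOfInfinite v w

end LocalDegree

/-! ### Degrees -/

section Degree

variable {K₀ : Type*} {K : Type u} {L : Type v} [Field K₀] [Field K] [Field L]
  [Algebra K₀ K] [Algebra K₀ L] [Algebra K L]

/-- Group the places of L into fibres over a finite set T of places of K; within a fibre the weights
add up to [L : K]. -/
theorem finprod_ramification_tower [Algebra.IsAlgebraic K L]
    (hK : {P : Place K | P.ramificationExponent K₀ ≠ 0}.Finite)
    (hL : {Q : Place L | Q.ramificationExponent K ≠ 0}.Finite)
    (htower : ∀ P : Place K, TowerFormula K₀ L P) :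
    ∏ᶠ Q : Place L, Q.norm ^ Q.ramificationExponent K₀ =
      (∏ᶠ P : Place K, P.norm ^ P.ramificationExponent K₀) ^ Module.finrank K L *
        ∏ᶠ Q : Place L, Q.norm ^ Q.ramificationExponent K := by
  classical
  choose s hs n hn hsum using htower
  -- T contains the places ramified over K₀ and those below places of L ramified over K.
  let T : Finset (Place K) := hK.toFinset ∪ hL.toFinset.image (Place.below K)
  let U : Finset (Place L) := T.biUnion s
  have hbelow : ∀ Q P, Q ∈ s P ↔ Q.below K = P := fun Q P => (hs P Q).trans below_eq_iff.symm
  have hdisj : (T : Set (Place K)).PairwiseDisjoint s := fun P _ P' _ hne =>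
    Finset.disjoint_left.mpr fun Q hQ hQ' =>
      hne (((hbelow _ _).mp hQ).symm.trans ((hbelow _ _).mp hQ'))
  have hmemU : ∀ Q, Q ∉ U → Q.below K ∉ T := fun Q hQ h =>
    hQ (Finset.mem_biUnion.mpr ⟨_, h, (hbelow _ _).mpr rfl⟩)
  have hr : ∀ Q, Q ∉ U → Q.ramificationExponent K = 0 := fun Q hQ => by
    by_contra hne
    exact hmemU Q hQ (Finset.mem_union_right _
      (Finset.mem_image_of_mem _ (hL.mem_toFinset.mpr hne)))
  have hrP : ∀ P, P ∉ T → P.ramificationExponent K₀ = 0 := fun P hP => by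
    by_contra hne
    exact hP (Finset.mem_union_left _ (hK.mem_toFinset.mpr hne))
  rw [finprod_eq_prod_of_mulSupport_subset (s := U), finprod_eq_prod_of_mulSupport_subset (s := T),
    finprod_eq_prod_of_mulSupport_subset (s := U), Finset.prod_biUnion hdisj,
    Finset.prod_biUnion hdisj, ← Finset.prod_pow, ← Finset.prod_mul_distrib]
  · refine Finset.prod_congr rfl fun P _ => ?_
    rw [Finset.prod_congr rfl (hn P), Finset.prod_mul_distrib, Finset.prod_pow_eq_pow_sum, hsum,
      mul_comm]
  · intro Q hQ
    by_contra h
    exact hQ (by dsimp only; rw [hr Q h, Real.rpow_zero])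
  · intro P hP
    by_contra h
    exact hP (by dsimp only; rw [hrP P h, Real.rpow_zero])
  · intro Q hQ
    by_contra h
    refine hQ ?_
    dsimp only
    -- Finiteness for L over K₀ is not assumed: off U the tower formula writes the factor as a
    -- product of two trivial ones.
    rw [hn _ Q ((hbelow _ _).mpr rfl), hr Q h, hrP _ (hmemU Q h), Real.rpow_zero, Real.rpow_zero,
      one_pow, one_mul]

theorem finprod_rpow_add (hpos : ∀ P : Place K, 0 < P.norm) {a b : Place K → ℝ}
    (ha : a.support.Finite) (hb : b.support.Finite) :
    ∏ᶠ P : Place K, P.norm ^ (a + b) P =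
      (∏ᶠ P : Place K, P.norm ^ a P) * ∏ᶠ P : Place K, P.norm ^ b P := by
  have hfin : ∀ {c : Place K → ℝ}, c.support.Finite →
      (Function.mulSupport fun P : Place K => P.norm ^ c P).Finite := fun hc =>
    hc.subset fun P hP h => hP (by dsimp only; rw [h, Real.rpow_zero])
  rw [← finprod_mul_distrib (hfin ha) (hfin hb)]
  exact finprod_congr fun P => Real.rpow_add (hpos P) _ _

variable (L) in
/-- The fibre over a nonarchimedean place, with the degree of the polar divisor. -/
theorem IsGlobal.exists_polar_fibre (hK : IsGlobal K) [FiniteDimensional K L]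
    [Algebra.IsSeparable K L] {P : Place K} (hP : ¬ P.IsArchimedean) :
    ∃ s : Finset (Place L), (∀ Q, Q ∈ s ↔ Q.LiesOver P) ∧
      ∏ Q ∈ s, Q.norm ^ (2 * (Q.ramificationIndex K : ℝ)) = P.norm ^ (2 * Module.finrank K L) := by
  have hpos := (hK.isLocal P hP).norm_pos
  obtain ⟨s, hs, -, f, hf, hsum⟩ := (hK.isLocal P hP).exists_fundamental_identity L
  refine ⟨s, hs, ?_⟩
  rw [← hsum, Finset.mul_sum, ← Finset.prod_pow_eq_pow_sum]
  refine Finset.prod_congr rfl fun Q hQ => ?_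
  rw [hf Q hQ, ← Real.rpow_natCast, ← Real.rpow_mul hpos.le, ← Real.rpow_natCast]
  congr 1
  push_cast
  ring

theorem IsGlobal.finite_support_polarDivisor (hK : IsGlobal K) [FiniteDimensional K L]
    [Algebra.IsSeparable K L] {P : Place K} (hP : ¬ P.IsArchimedean) :
    (polarDivisor L P).support.Finite := by
  obtain ⟨s, hs, -⟩ := hK.exists_polar_fibre L hP
  refine s.finite_toSet.subset fun Q hQ => (hs Q).mpr ?_
  by_contra h
  exact hQ (if_neg h)

theorem IsGlobal.polarDivisor_mem (hK : IsGlobal K) [FiniteDimensional K L]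
    [Algebra.IsSeparable K L] {P : Place K} (hP : ¬ P.IsArchimedean) :
    polarDivisor L P ∈ divisors L := by
  refine ⟨hK.finite_support_polarDivisor hP, fun Q _ => ?_⟩
  rw [polarDivisor]
  split_ifs
  · exact ⟨2 * Q.ramificationIndex K, by push_cast; rfl⟩
  · exact ⟨0, by simp⟩

theorem IsGlobal.finprod_polarDivisor (hK : IsGlobal K) [FiniteDimensional K L]
    [Algebra.IsSeparable K L] {P : Place K} (hP : ¬ P.IsArchimedean) :
    ∏ᶠ Q : Place L, Q.norm ^ polarDivisor L P Q = P.norm ^ (2 * Module.finrank K L) := by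
  obtain ⟨s, hs, hprod⟩ := hK.exists_polar_fibre L hP
  rw [← hprod, finprod_eq_prod_of_mulSupport_subset (s := s)]
  · refine Finset.prod_congr rfl fun Q hQ => ?_
    rw [polarDivisor, if_pos ((hs Q).mp hQ)]
  · intro Q hQ
    by_contra h
    refine hQ ?_
    dsimp only
    rw [polarDivisor, if_neg fun hl => h ((hs Q).mpr hl), Real.rpow_zero]

/-- The coefficient is the logarithm to base N(Q) of the degree of the polar divisor. The base must
differ from 1 for exponentiation to undo it. -/
theorem norm_rpow_archimedeanCoefficient [NumberField L] {P₀ : Place ℚ}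
    (hP₀ : ¬ P₀.IsArchimedean) {Q : Place L} (hQ : 1 < Q.norm) :
    Q.norm ^ archimedeanCoefficient P₀ Q = P₀.norm ^ (2 * Module.finrank ℚ L) := by
  obtain ⟨s, hs, hprod⟩ := isGlobal_rat.exists_polar_fibre L hP₀
  have hpos := (isGlobal_rat.extension L).norm_pos
  have h : archimedeanCoefficient P₀ Q =
      ∑ R ∈ s, 2 * (R.ramificationIndex ℚ : ℝ) * Real.logb Q.norm R.norm := by
    rw [archimedeanCoefficient, ← finsum_mem_finset_eq_sum]
    exact finsum_congr fun R => by rw [hs R]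
  rw [h, ← hprod, Real.rpow_sum_of_pos (hpos Q)]
  refine Finset.prod_congr rfl fun R _ => ?_
  rw [mul_comm, Real.rpow_mul (hpos Q).le, Real.rpow_logb (hpos Q) hQ.ne' (hpos R)]

theorem IsGlobal.ramificationDivisor_mem (hK : IsGlobal K) [FiniteDimensional K L]
    [Algebra.IsSeparable K L] (hfin : {Q : Place L | Q.IsArchimedean}.Finite) :
    ramificationDivisor K L ∈ divisors L := by
  refine ⟨((hK.finite_ramification K L).union hfin).subset fun Q hQ => ?_, fun Q hQ => ?_⟩
  · by_cases h : Q.IsArchimedean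
    · exact Or.inr h
    · exact Or.inl ⟨h, hQ⟩
  · obtain ⟨d, -, hd⟩ := (hK.extension L).exists_ramificationExponent_eq K hQ
    exact ⟨d, by rw [ramificationDivisor, hd, Int.cast_natCast]⟩

end Degree

/-! ### Canonical divisors -/

section Canonical

open NumberField

theorem ramificationDivisor_mem_of_numberField (K : Type u) (L : Type v) [Field K] [NumberField K]
    [Field L] [NumberField L] [Algebra K L] : ramificationDivisor K L ∈ divisors L :=
  (isGlobal_rat.extension K).ramificationDivisor_mem (finite_isArchimedean L)

open Classical in
theorem single_mem_divisors {K : Type u} [Field K] {P : Place K}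
    (hP : P.IsArchimedean) (a : ℝ) : (Pi.single P a : Place K → ℝ) ∈ divisors K := by
  refine ⟨(Set.finite_singleton P).subset Pi.support_single_subset, fun Q hQ => ⟨0, ?_⟩⟩
  rw [Pi.single_eq_of_ne (by rintro rfl; exact hQ hP), Int.cast_zero]

theorem one_lt_norm_of_isArchimedean {K : Type u} [Field K] [NumberField K] {P : Place K}
    (hP : P.IsArchimedean) : 1 < P.norm := by
  obtain ⟨v, rfl⟩ := exists_placeOfInfinite_eq hP
  rw [norm_placeOfInfinite]
  exact Real.one_lt_exp_iff.mpr (by exact_mod_cast v.mult_pos)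

theorem canonicalDivisorNumberField_mem {K : Type u} [Field K] [NumberField K] {P₀ : Place ℚ}
    {Pinf : Place K} (hP₀ : ¬ P₀.IsArchimedean) (hPinf : Pinf.IsArchimedean) :
    canonicalDivisorNumberField P₀ Pinf ∈ divisors K :=
  add_mem (sub_mem (ramificationDivisor_mem_of_numberField ℚ K) (isGlobal_rat.polarDivisor_mem hP₀))
    (single_mem_divisors hPinf _)

/-- The polar divisor and the archimedean term have the same degree N(P₀) ^ (2[K:ℚ]), so they cancel
and only the ramification divisor is left. -/
theorem degree_canonicalDivisorNumberField {K : Type u} [Field K] [NumberField K] {P₀ : Place ℚ}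
    {Pinf : Place K} (hP₀ : ¬ P₀.IsArchimedean) (hPinf : Pinf.IsArchimedean) :
    degree ⟨_, canonicalDivisorNumberField_mem hP₀ hPinf⟩ =
      ∏ᶠ P : Place K, P.norm ^ P.ramificationExponent ℚ := by
  classical
  have hpos := (isGlobal_rat.extension K).norm_pos
  have hR := ramificationDivisor_mem_of_numberField ℚ K
  have hpol := isGlobal_rat.polarDivisor_mem (L := K) hP₀
  have hs := single_mem_divisors hPinf (archimedeanCoefficient P₀ Pinf)
  have h1 := finprod_rpow_add hpos (canonicalDivisorNumberField_mem hP₀ hPinf).1 hpol.1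
  have h2 : canonicalDivisorNumberField P₀ Pinf + polarDivisor K P₀ =
      ramificationDivisor ℚ K + Pi.single Pinf (archimedeanCoefficient P₀ Pinf) := by
    rw [canonicalDivisorNumberField]
    abel
  have h3 : ∏ᶠ P : Place K, P.norm ^ (Pi.single Pinf (archimedeanCoefficient P₀ Pinf) :
      Place K → ℝ) P = P₀.norm ^ (2 * Module.finrank ℚ K) := by
    rw [← norm_rpow_archimedeanCoefficient hP₀ (one_lt_norm_of_isArchimedean hPinf),
      finprod_eq_single _ Pinf, Pi.single_eq_same]
    intro Q hQ
    rw [Pi.single_eq_of_ne hQ, Real.rpow_zero]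
  rw [h2, finprod_rpow_add hpos hR.1 hs.1, h3, isGlobal_rat.finprod_polarDivisor hP₀] at h1
  exact (mul_right_cancel₀ (pow_ne_zero _ (isGlobal_rat.norm_pos P₀).ne') h1).symm

theorem IsGlobal.canonicalDivisorFunctionField_mem {K₀ : Type*} {K : Type u} [Field K₀] [Field K]
    [Algebra K₀ K] [FiniteDimensional K₀ K] [Algebra.IsSeparable K₀ K] (hK₀ : IsGlobal K₀)
    (harch : ∀ P : Place K, ¬ P.IsArchimedean) {P₀ : Place K₀} (hP₀ : ¬ P₀.IsArchimedean) :
    canonicalDivisorFunctionField K P₀ ∈ divisors K :=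
  sub_mem (hK₀.ramificationDivisor_mem (by simp [harch])) (hK₀.polarDivisor_mem hP₀)

/-- Adding the polar divisor back to the canonical one gives the ramification divisor; the extra
factor is the degree of the polar divisor. -/
theorem IsGlobal.degree_canonicalDivisorFunctionField {K₀ : Type*} {K : Type u} [Field K₀] [Field K]
    [Algebra K₀ K] [FiniteDimensional K₀ K] [Algebra.IsSeparable K₀ K] (hK₀ : IsGlobal K₀)
    (harch : ∀ P : Place K, ¬ P.IsArchimedean) {P₀ : Place K₀} (hP₀ : ¬ P₀.IsArchimedean) :
    degree ⟨_, hK₀.canonicalDivisorFunctionField_mem harch hP₀⟩ *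
      P₀.norm ^ (2 * Module.finrank K₀ K) =
      ∏ᶠ P : Place K, P.norm ^ P.ramificationExponent K₀ := by
  have h1 := finprod_rpow_add (hK₀.extension K).norm_pos
    (hK₀.canonicalDivisorFunctionField_mem harch hP₀).1 (hK₀.polarDivisor_mem (L := K) hP₀).1
  rw [hK₀.finprod_polarDivisor hP₀, canonicalDivisorFunctionField, sub_add_cancel] at h1
  exact h1.symm

end Canonical

end GlobalField

end

/-! ### The main theorem in both characteristics -/

theorem theorem3p1 :
    -- characteristic zero
    (∀ (K : Type*) (L : Type*) [Field K] [NumberField K] [Field L] [NumberField L] [Algebra K L]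
      (P₀ P₀' : GlobalField.Place ℚ) (Pinf : GlobalField.Place K) (Qinf : GlobalField.Place L),
      ¬ P₀.IsArchimedean → ¬ P₀'.IsArchimedean → Pinf.IsArchimedean → Qinf.IsArchimedean →
      ∃ (hR : GlobalField.ramificationDivisor K L ∈ GlobalField.divisors L)
        (hK : GlobalField.canonicalDivisorNumberField P₀ Pinf ∈ GlobalField.divisors K)
        (hL : GlobalField.canonicalDivisorNumberField P₀' Qinf ∈ GlobalField.divisors L),
        GlobalField.degree ⟨_, hL⟩ =
          GlobalField.degree ⟨_, hK⟩ ^ Module.finrank K L * GlobalField.degree ⟨_, hR⟩) ∧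
    -- positive characteristic
    (∀ (F : Type*) [Field F] [Finite F] (K : Type*) (L : Type*) [Field K] [Field L]
      [Algebra (RatFunc F) K] [Algebra (RatFunc F) L] [Algebra K L]
      [IsScalarTower (RatFunc F) K L]
      [FiniteDimensional (RatFunc F) K] [Algebra.IsSeparable (RatFunc F) K]
      [FiniteDimensional K L] [Algebra.IsSeparable K L]
      (P₀ P₀' : GlobalField.Place (RatFunc F)),
      ¬ P₀.IsArchimedean → P₀.norm = Nat.card F → ¬ P₀'.IsArchimedean → P₀'.norm = Nat.card F →
      ∃ (hR : GlobalField.ramificationDivisor K L ∈ GlobalField.divisors L)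
        (hK : GlobalField.canonicalDivisorFunctionField K P₀ ∈ GlobalField.divisors K)
        (hL : GlobalField.canonicalDivisorFunctionField L P₀' ∈ GlobalField.divisors L),
        GlobalField.degree ⟨_, hL⟩ =
          GlobalField.degree ⟨_, hK⟩ ^ Module.finrank K L * GlobalField.degree ⟨_, hR⟩) := by
  open GlobalField in
  refine ⟨?_, ?_⟩
  · intro K L _ _ _ _ _ P₀ P₀' Pinf Qinf hP₀ hP₀' hPinf hQinf
    have hK := isGlobal_rat.extension K
    refine ⟨ramificationDivisor_mem_of_numberField K L, canonicalDivisorNumberField_mem hP₀ hPinf,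
      canonicalDivisorNumberField_mem hP₀' hQinf, ?_⟩
    rw [degree_canonicalDivisorNumberField hP₀ hPinf, degree_canonicalDivisorNumberField hP₀' hQinf]
    exact finprod_ramification_tower (ramificationDivisor_mem_of_numberField ℚ K).1
      (ramificationDivisor_mem_of_numberField K L).1 fun P => by
        by_cases hP : P.IsArchimedean
        · exact towerFormula_of_isArchimedean L hP
        · exact hK.towerFormula L hP
  · intro F _ _ K L _ _ _ _ _ _ _ _ _ _ P₀ P₀' hP₀ hN hP₀' hN'
    have := FiniteDimensional.trans (RatFunc F) K L
    have := Algebra.IsSeparable.trans (RatFunc F) K L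
    -- The constant field forces every absolute value on K and L to be nonarchimedean.
    let : Algebra F K := ((algebraMap (RatFunc F) K).comp (algebraMap F (RatFunc F))).toAlgebra
    let : Algebra F L := ((algebraMap (RatFunc F) L).comp (algebraMap F (RatFunc F))).toAlgebra
    have hF := isGlobal_ratFunc (F := F)
    have hK := hF.extension K
    have hKna : ∀ P : Place K, ¬ P.IsArchimedean := not_isArchimedean_of_finite F
    have hLna : ∀ Q : Place L, ¬ Q.IsArchimedean := not_isArchimedean_of_finite F
    have hR := hK.ramificationDivisor_mem (L := L) (by simp [hLna])
    have hR₀ := hF.ramificationDivisor_mem (L := K) (by simp [hKna])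
    refine ⟨hR, hF.canonicalDivisorFunctionField_mem hKna hP₀,
      hF.canonicalDivisorFunctionField_mem hLna hP₀', ?_⟩
    have h := finprod_ramification_tower (K₀ := RatFunc F) hR₀.1 hR.1
      fun P => hK.towerFormula L (hKna P)
    -- Both chosen places have norm q, so (q ^ (2[K:K₀])) ^ [L:K] = q ^ (2[L:K₀]) cancels from the
    -- two sides.
    rw [← hF.degree_canonicalDivisorFunctionField hLna hP₀',
      ← hF.degree_canonicalDivisorFunctionField hKna hP₀, hN, hN', mul_pow, ← pow_mul, mul_assoc 2,
      Module.finrank_mul_finrank, mul_right_comm] at h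
    exact mul_right_cancel₀ (pow_ne_zero _ (Nat.cast_ne_zero.mpr Nat.card_pos.ne')) h
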